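/- Let $T=\mathbb C^2/\Lambda$ be a two-dimensional complex torus ($\Lambda\subset\mathbb C^2$ a lattice) and let $F\colon T\dashrightarrow\mathbb P^1$ be a meromorphic map, that is, near every point $F=[f:g]$ with $f,g$ holomorphic and without common factor. For $\lambda=[a:b]\in\mathbb P^1$, the fiber $F^{-1}(\lambda)$ is the divisor defined locally by $bf-ag=0$; its support contains the points of indeterminacy of $F$. The fiber is called linear if its support is a (nonempty) union of translates of one-dimensional subtori of $T$, and reduced if its local equations $bf-ag$ are nowhere divisible by the square of a non-unit holomorphic germ, i.e. if the divisor has no multiple component. Let $k$ be the number of $\lambda\in\mathbb P^1$ such that $F^{-1}(\lambda)$ is linear. If $k$ is finite, then $k\le 6$. Moreover, if $k=6$, then every fiber $F^{-1}(\lambda)$, $\lambda\in\mathbb P^1$ (linear or not), is reduced. -/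

import Mathlib

open Filter Topology
open scoped LinearAlgebra.Projectivization

namespace ComplexTorus

/-- The complex projective line, with points `[a : b]`. -/
abbrev P1 : Type := ℙ ℂ (ℂ × ℂ)

/-- The two-dimensional complex torus `ℂ² / Λ` (for `Λ` a lattice). -/
abbrev Torus (Λ : Submodule ℤ (ℂ × ℂ)) : Type := (ℂ × ℂ) ⧸ Λ

/-- The projection `ℂ² → ℂ² / Λ`. Its local inverses are the holomorphic charts of the torus, so
that functions holomorphic near `proj Λ p` are the functions holomorphic near `p`. -/
def proj (Λ : Submodule ℤ (ℂ × ℂ)) (x : ℂ × ℂ) : Torus Λ := Submodule.Quotient.mk x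

/-- Let `Γ` be a subset of `T × P¹`, where `T = ℂ² / Λ`. The pair `(f, g)` is a reduced
representation of `Γ` at the point `p`: both functions are holomorphic near `p`, they have at most
the isolated common zero `p` (in dimension two: they have no common factor), and near `p` the set
`Γ` is the graph of `[f : g]`, that is `Γ = {(x, [a : b]) | f x * b = g x * a}`; over a common zero
of `f` and `g` (a point of indeterminacy) it contains the whole of `P¹`. -/
structure IsLocalRep {Λ : Submodule ℤ (ℂ × ℂ)} (Γ : Set (Torus Λ × P1))
    (p : ℂ × ℂ) (f g : ℂ × ℂ → ℂ) : Prop where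
  analytic_left : AnalyticAt ℂ f p
  analytic_right : AnalyticAt ℂ g p
  isolated : ∀ᶠ x in 𝓝[≠] p, f x ≠ 0 ∨ g x ≠ 0
  mem_graph_iff : ∀ᶠ x in 𝓝 p, ∀ (a b : ℂ) (h : (a, b) ≠ (0 : ℂ × ℂ)),
    ((proj Λ x, Projectivization.mk ℂ (a, b) h) ∈ Γ ↔ f x * b = g x * a)

/-- A meromorphic map `ℂ² / Λ ⇢ P¹`, given by its graph (the closure of the graph of the map
outside its points of indeterminacy): near every point it is `[f : g]` with holomorphic `f` and `g`
that have no common factor. -/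
structure MeromorphicMap (Λ : Submodule ℤ (ℂ × ℂ)) where
  /-- The graph. -/
  graph : Set (Torus Λ × P1)
  /-- The map is locally a reduced quotient of holomorphic functions. -/
  exists_localRep : ∀ p : ℂ × ℂ, ∃ f g : ℂ × ℂ → ℂ, IsLocalRep graph p f g

/-- A one-dimensional subtorus of `ℂ² / Λ`, or a translate of one: the image of an affine complex
line `q + L` such that `Λ ∩ L` is a lattice in `L`. -/
def IsSubtorus (Λ : Submodule ℤ (ℂ × ℂ)) (E : Set (Torus Λ)) : Prop :=
  ∃ (L : Submodule ℂ (ℂ × ℂ)) (q : ℂ × ℂ),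
    Module.finrank ℂ L = 1 ∧
    Submodule.span ℝ ((Λ : Set (ℂ × ℂ)) ∩ (L : Set (ℂ × ℂ))) = L.restrictScalars ℝ ∧
    E = (fun v => proj Λ (q + v)) '' (L : Set (ℂ × ℂ))

namespace MeromorphicMap

variable {Λ : Submodule ℤ (ℂ × ℂ)}

/-- The support of the fiber over `c`, indeterminacy points included. -/
def fiber (F : MeromorphicMap Λ) (c : P1) : Set (Torus Λ) :=
  {t | (t, c) ∈ F.graph}

/-- The fiber over `c` is linear: set-theoretically it is a (nonempty) union of translates of
one-dimensional subtori. -/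
def IsLinearFiber (F : MeromorphicMap Λ) (c : P1) : Prop :=
  ∃ S : Set (Set (Torus Λ)), S.Nonempty ∧ (∀ E ∈ S, IsSubtorus Λ E) ∧ F.fiber c = ⋃₀ S

/-- The fiber over `c = [a : b]`, which as a divisor is locally defined by `f * b - g * a = 0`, is
reduced: nowhere is its local equation divisible by the square of a holomorphic germ `h` that is
not a unit. -/
def IsReducedFiber (F : MeromorphicMap Λ) (c : P1) : Prop :=
  ∀ (p : ℂ × ℂ) (f g : ℂ × ℂ → ℂ), IsLocalRep F.graph p f g →
    ∀ (a b : ℂ) (hab : (a, b) ≠ (0 : ℂ × ℂ)), Projectivization.mk ℂ (a, b) hab = c →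
      ∀ h m : ℂ × ℂ → ℂ, AnalyticAt ℂ h p → AnalyticAt ℂ m p →
        (∀ᶠ x in 𝓝 p, f x * b - g x * a = h x ^ 2 * m x) → h p ≠ 0

end MeromorphicMap

end ComplexTorus

/-!
The number of linear fibers is bounded with the help of the inflection form of the pencil.

Write `F = [f : g]` locally, let `A` and `B` be the Wronskians of `f` and `g` in the two coordinate
directions, and let `K = A_x B² - (A_y + B_x) A B + B_y A²`; up to the factor `g ^ 6` this is the
Hessian form `φ_xx φ_y² - 2 φ_xy φ_x φ_y + φ_yy φ_x²` of `φ = f / g`. It is multiplied by `w ^ 6`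
when the representation is multiplied by a unit `w` (`infl_mul`), by a constant when another basis
of the pencil or another frame of constant fields is used (`infl_linear`, `infl_frame`), and it
vanishes where the level curves of `F` have an inflection.

Along a line that the fiber over `c` contains with multiplicity `m`, the form `K` vanishes at least to
order `3 m - 2 = m + (2 m - 2)` (`VanishesTo.ordGE_infl`). If six fibers are linear, the quotient `Q` of
`K` by the product of the six local equations is therefore a well defined function on the torus
that is bounded near each generic point of these fibers; the points that are not generic are
countable (`IsLinearFiber.countable_not_isGood`), and the maximum principle on discs avoiding them
shows that `Q` is locally bounded everywhere, the points of indeterminacy included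
(`exists_bound_nhds`). As the torus is compact, `Q` is bounded, and Liouville's theorem on complex
lines makes it a constant `κ` (`exists_quotFun_eq_const`).

* If `κ = 0`, then `K = 0`, so the level curves are straight. Then a line of the fiber goes through
  each point of each fiber (`hasLine_of_infl_eq_zero`), such a line is a subtorus since otherwise
  its translates by periods would fill everything (`span_period_eq`), and there are infinitely many
  linear fibers (`infinite_of_infl_eq_zero`).
* If there is a seventh linear fiber, then `K`, and with it `Q`, vanishes at points of it where
  none of the six equations vanishes, so `κ = 0` (`const_eq_zero_of_linear`).
* If some fiber has a multiple component, then `Q` vanishes on that component: because `K`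
  does if the fiber is not one of the six, and to order `2 m - 2 ≥ 2` otherwise. Again `κ = 0`
  (`const_eq_zero_of_not_reduced`).

All functions are lifted to `ℂ²`, and only germs, complex lines and discs are used, so that neither
line bundles nor the divisor theory of complex surfaces are needed.
-/

namespace ComplexTorus

/-! ### Directional derivatives and the inflection form -/

/-- The derivative of `f` along the constant vector field `v`. -/
noncomputable def dirD (v : ℂ × ℂ) (f : ℂ × ℂ → ℂ) : ℂ × ℂ → ℂ := fun x => fderiv ℂ f x v

/-- The Wronskian of `f` and `g` along `v`; it is `g ^ 2` times the derivative of `f / g`. -/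
noncomputable def wr (v : ℂ × ℂ) (f g : ℂ × ℂ → ℂ) : ℂ × ℂ → ℂ :=
  fun x => dirD v f x * g x - f x * dirD v g x

/-- The cubic form whose vanishing says that the integral curves of the vector field
`B ∂_d - A ∂_e` have no curvature. -/
noncomputable def curv (d e : ℂ × ℂ) (A B : ℂ × ℂ → ℂ) : ℂ × ℂ → ℂ := fun x =>
  dirD d A x * B x ^ 2 - (dirD e A x + dirD d B x) * (A x * B x) + dirD e B x * A x ^ 2

/-- The inflection form of the pencil spanned by `f` and `g`, computed in the directions `d`, `e`:
it vanishes where the level curves of `f / g` have an inflection. -/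
noncomputable def infl (d e : ℂ × ℂ) (f g : ℂ × ℂ → ℂ) : ℂ × ℂ → ℂ := curv d e (wr d f g) (wr e f g)

/-- The determinant of two vectors of `ℂ²`. -/
noncomputable def cross (v w : ℂ × ℂ) : ℂ := v.1 * w.2 - v.2 * w.1

variable {f g A B A' B' ρ w : ℂ × ℂ → ℂ} {x d e v : ℂ × ℂ}

lemma analyticAt_dirD (hf : AnalyticAt ℂ f x) (v : ℂ × ℂ) : AnalyticAt ℂ (dirD v f) x :=
  ((ContinuousLinearMap.apply ℂ ℂ v).analyticAt _).comp hf.fderiv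

lemma analyticAt_iterate_dirD (hf : AnalyticAt ℂ f x) (v : ℂ × ℂ) (k : ℕ) :
    AnalyticAt ℂ ((dirD v)^[k] f) x := by
  induction k generalizing f with
  | zero => exact hf
  | succ k ih => exact ih (analyticAt_dirD hf v)

lemma analyticAt_wr (hf : AnalyticAt ℂ f x) (hg : AnalyticAt ℂ g x) (v : ℂ × ℂ) :
    AnalyticAt ℂ (wr v f g) x :=
  ((analyticAt_dirD hf v).mul hg).sub (hf.mul (analyticAt_dirD hg v))

lemma analyticAt_curv (hA : AnalyticAt ℂ A x) (hB : AnalyticAt ℂ B x) (d e : ℂ × ℂ) :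
    AnalyticAt ℂ (curv d e A B) x :=
  (((analyticAt_dirD hA d).mul (hB.pow 2)).sub (((analyticAt_dirD hA e).add
    (analyticAt_dirD hB d)).mul (hA.mul hB))).add ((analyticAt_dirD hB e).mul (hA.pow 2))

lemma analyticAt_infl (hf : AnalyticAt ℂ f x) (hg : AnalyticAt ℂ g x) (d e : ℂ × ℂ) :
    AnalyticAt ℂ (infl d e f g) x :=
  analyticAt_curv (analyticAt_wr hf hg d) (analyticAt_wr hf hg e) d e

lemma dirD_congr (h : f =ᶠ[𝓝 x] g) (v : ℂ × ℂ) : dirD v f =ᶠ[𝓝 x] dirD v g :=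
  (h.fderiv (𝕜 := ℂ)).mono fun y hy => by simp only [dirD, hy]

lemma iterate_dirD_congr (h : f =ᶠ[𝓝 x] g) (v : ℂ × ℂ) (k : ℕ) :
    (dirD v)^[k] f =ᶠ[𝓝 x] (dirD v)^[k] g := by
  induction k generalizing f g with
  | zero => exact h
  | succ k ih => exact ih (dirD_congr h v)

lemma dirD_mul (hf : AnalyticAt ℂ f x) (hg : AnalyticAt ℂ g x) (v : ℂ × ℂ) :
    dirD v (fun y => f y * g y) x = dirD v f x * g x + f x * dirD v g x := by
  simp only [dirD]
  rw [fderiv_fun_mul hf.differentiableAt hg.differentiableAt]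
  simp; ring

lemma dirD_add (hf : AnalyticAt ℂ f x) (hg : AnalyticAt ℂ g x) (v : ℂ × ℂ) :
    dirD v (fun y => f y + g y) x = dirD v f x + dirD v g x := by
  simp only [dirD]
  rw [fderiv_fun_add hf.differentiableAt hg.differentiableAt]
  simp

lemma dirD_sub (hf : AnalyticAt ℂ f x) (hg : AnalyticAt ℂ g x) (v : ℂ × ℂ) :
    dirD v (fun y => f y - g y) x = dirD v f x - dirD v g x := by
  simp only [dirD]
  rw [fderiv_fun_sub hf.differentiableAt hg.differentiableAt]
  simp

lemma dirD_const_mul (hf : AnalyticAt ℂ f x) (c : ℂ) (v : ℂ × ℂ) :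
    dirD v (fun y => c * f y) x = c * dirD v f x := by
  simp only [dirD]
  rw [fderiv_const_mul hf.differentiableAt]
  simp

lemma dirD_eq_coord (v : ℂ × ℂ) (f : ℂ × ℂ → ℂ) (x : ℂ × ℂ) :
    dirD v f x = v.1 * dirD (1, 0) f x + v.2 * dirD (0, 1) f x := by
  have : v = v.1 • ((1, 0) : ℂ × ℂ) + v.2 • ((0, 1) : ℂ × ℂ) := by ext <;> simp
  simp only [dirD]
  conv_lhs => rw [this]
  rw [map_add, map_smul, map_smul]; simp

lemma dirD_comm (hf : AnalyticAt ℂ f x) (d e : ℂ × ℂ) :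
    dirD d (dirD e f) x = dirD e (dirD d f) x := by
  have h2 : ∀ d e : ℂ × ℂ, dirD d (dirD e f) x = fderiv ℂ (fderiv ℂ f) x d e := by
    intro d e
    have := ((ContinuousLinearMap.apply ℂ ℂ e).hasFDerivAt.comp x
      hf.fderiv.differentiableAt.hasFDerivAt).fderiv
    simp only [dirD]
    change fderiv ℂ ((ContinuousLinearMap.apply ℂ ℂ e) ∘ fderiv ℂ f) x d = _
    rw [this]; simp
  rw [h2, h2]
  exact (ContDiffAt.isSymmSndFDerivAt_of_omega hf.contDiffAt) d e

lemma hasDerivAt_line {t : ℂ} (hf : AnalyticAt ℂ f (x + t • v)) :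
    HasDerivAt (fun s : ℂ => f (x + s • v)) (dirD v f (x + t • v)) t := by
  have h1 : HasDerivAt (fun s : ℂ => x + s • v) v t := by
    simpa using ((hasDerivAt_id t).smul_const v).const_add x
  exact hf.differentiableAt.hasFDerivAt.comp_hasDerivAt t h1

lemma analyticAt_line {t : ℂ} (hf : AnalyticAt ℂ f (x + t • v)) :
    AnalyticAt ℂ (fun s : ℂ => f (x + s • v)) t :=
  hf.comp_of_eq (analyticAt_const.add (analyticAt_id.smul analyticAt_const)) rfl

lemma tendsto_line (x v : ℂ × ℂ) (t : ℂ) :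
    Tendsto (fun s : ℂ => x + s • v) (𝓝 t) (𝓝 (x + t • v)) :=
  Continuous.tendsto (by fun_prop) t

lemma curv_of_eq_mul (hA : AnalyticAt ℂ A x) (hB : AnalyticAt ℂ B x) (hρ : AnalyticAt ℂ ρ x)
    (hA' : A' =ᶠ[𝓝 x] fun y => ρ y * A y) (hB' : B' =ᶠ[𝓝 x] fun y => ρ y * B y) :
    curv d e A' B' x = ρ x ^ 3 * curv d e A B x := by
  simp only [curv]
  rw [(dirD_congr hA' d).eq_of_nhds, (dirD_congr hA' e).eq_of_nhds,
    (dirD_congr hB' d).eq_of_nhds, (dirD_congr hB' e).eq_of_nhds, hA'.eq_of_nhds, hB'.eq_of_nhds,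
    dirD_mul hρ hA, dirD_mul hρ hA, dirD_mul hρ hB, dirD_mul hρ hB]
  ring

lemma wr_congr {f' g' : ℂ × ℂ → ℂ} (hf : f =ᶠ[𝓝 x] f') (hg : g =ᶠ[𝓝 x] g') (v : ℂ × ℂ) :
    wr v f g =ᶠ[𝓝 x] wr v f' g' := by
  filter_upwards [hf, hg, dirD_congr hf v, dirD_congr hg v] with y h1 h2 h3 h4
  simp [wr, h1, h2, h3, h4]

/-- The inflection form has degree six in the pencil. -/
lemma infl_mul {f' g' : ℂ × ℂ → ℂ} (hf : AnalyticAt ℂ f x) (hg : AnalyticAt ℂ g x)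
    (hw : AnalyticAt ℂ w x) (hf' : f' =ᶠ[𝓝 x] fun y => w y * f y)
    (hg' : g' =ᶠ[𝓝 x] fun y => w y * g y) :
    infl d e f' g' x = w x ^ 6 * infl d e f g x := by
  have key : ∀ v, wr v f' g' =ᶠ[𝓝 x] fun y => (w y ^ 2) * wr v f g y := by
    intro v
    filter_upwards [wr_congr hf' hg' v, hf.eventually_analyticAt, hg.eventually_analyticAt,
      hw.eventually_analyticAt] with y h1 h2 h3 h4
    rw [h1]
    simp only [wr]
    rw [dirD_mul h4 h2, dirD_mul h4 h3]
    ring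
  rw [infl, curv_of_eq_mul (analyticAt_wr hf hg d) (analyticAt_wr hf hg e) (hw.pow 2) (key d)
    (key e), infl]
  simp only [Pi.pow_apply]; ring

/-- The inflection form of another basis of the pencil. -/
lemma infl_linear (hf : AnalyticAt ℂ f x) (hg : AnalyticAt ℂ g x) (a b a' b' : ℂ) :
    infl d e (fun y => f y * b - g y * a) (fun y => f y * b' - g y * a') x =
      (a * b' - a' * b) ^ 3 * infl d e f g x := by
  have key : ∀ v, wr v (fun y => f y * b - g y * a) (fun y => f y * b' - g y * a') =ᶠ[𝓝 x]
      fun y => (a * b' - a' * b) * wr v f g y := by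
    intro v
    filter_upwards [hf.eventually_analyticAt, hg.eventually_analyticAt] with y h2 h3
    have h4 : ∀ a b : ℂ, dirD v (fun y => f y * b - g y * a) y =
        dirD v f y * b - dirD v g y * a := by
      intro a b
      rw [dirD_sub (f := fun y => f y * b) (g := fun y => g y * a) (h2.mul analyticAt_const)
        (h3.mul analyticAt_const), dirD_mul h2 analyticAt_const, dirD_mul h3 analyticAt_const]
      simp [dirD]
    simp only [wr]
    rw [h4, h4]
    ring
  rw [infl, curv_of_eq_mul (analyticAt_wr hf hg d) (analyticAt_wr hf hg e)
    (ρ := fun _ => a * b' - a' * b) analyticAt_const (key d) (key e), infl]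

/-- The inflection form in another frame of constant vector fields. -/
lemma infl_frame (hf : AnalyticAt ℂ f x) (hg : AnalyticAt ℂ g x) (d e : ℂ × ℂ) :
    infl d e f g x = cross d e ^ 2 * infl (1, 0) (0, 1) f g x := by
  have key : ∀ v, wr v f g = fun y => v.1 * wr (1, 0) f g y + v.2 * wr (0, 1) f g y := by
    intro v; funext y
    simp only [wr]; rw [dirD_eq_coord v f, dirD_eq_coord v g]; ring
  have h1 := analyticAt_wr hf hg (1, 0)
  have h2 := analyticAt_wr hf hg (0, 1)
  have key2 : ∀ u v, dirD u (wr v f g) x =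
      v.1 * (u.1 * dirD (1, 0) (wr (1, 0) f g) x + u.2 * dirD (0, 1) (wr (1, 0) f g) x) +
      v.2 * (u.1 * dirD (1, 0) (wr (0, 1) f g) x + u.2 * dirD (0, 1) (wr (0, 1) f g) x) := by
    intro u v
    rw [key v, dirD_add (f := fun y => v.1 * wr (1, 0) f g y)
      (g := fun y => v.2 * wr (0, 1) f g y) (analyticAt_const.mul h1) (analyticAt_const.mul h2),
      dirD_const_mul h1,
      dirD_const_mul h2, dirD_eq_coord u (wr (1, 0) f g), dirD_eq_coord u (wr (0, 1) f g)]
  simp only [infl, curv]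
  rw [key2 d d, key2 e d, key2 d e, key2 e e, congrFun (key d) x, congrFun (key e) x]
  simp only [cross]
  ring

lemma infl_eq_zero_of_critical {x : ℂ × ℂ} (h1 : wr d f g x = 0) (h2 : wr e f g x = 0) :
    infl d e f g x = 0 := by
  simp [infl, curv, h1, h2]

lemma cross_smul_eq (d e x : ℂ × ℂ) :
    cross d e • x = cross x e • d + cross d x • e := by
  ext <;> simp [cross] <;> ring

end ComplexTorus

namespace ComplexTorus

/-! ### Order of vanishing along a line -/

open Asymptotics

/-- The derivatives of `w` of order less than `m` in the direction `e` vanish on the line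
`σ (z - q) = 0`, near `q`. -/
def VanishesTo (σ : ℂ × ℂ →L[ℂ] ℂ) (e q : ℂ × ℂ) (m : ℕ) (w : ℂ × ℂ → ℂ) : Prop :=
  ∀ k < m, ∀ᶠ z in 𝓝 q, σ (z - q) = 0 → (dirD e)^[k] w z = 0

variable {σ : ℂ × ℂ →L[ℂ] ℂ} {d e q : ℂ × ℂ} {m j k : ℕ} {u w : ℂ × ℂ → ℂ}

lemma VanishesTo.dirD_transverse (h : VanishesTo σ e q m w) :
    VanishesTo σ e q (m - 1) (dirD e w) := fun k hk => by
  have := h (k + 1) (by omega)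
  simpa [Function.iterate_succ_apply] using this

lemma iterate_dirD_comm (hw : AnalyticAt ℂ w q) (d e : ℂ × ℂ) (k : ℕ) :
    (dirD e)^[k] (dirD d w) =ᶠ[𝓝 q] dirD d ((dirD e)^[k] w) := by
  induction k generalizing w with
  | zero => rfl
  | succ k ih =>
    have h1 : dirD e (dirD d w) =ᶠ[𝓝 q] dirD d (dirD e w) :=
      hw.eventually_analyticAt.mono fun y hy => dirD_comm hy e d
    exact (iterate_dirD_congr h1 e k).trans (ih (analyticAt_dirD hw e))

lemma VanishesTo.dirD_tangent (h : VanishesTo σ e q m w) (hw : AnalyticAt ℂ w q) (hd : σ d = 0) :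
    VanishesTo σ e q m (dirD d w) := fun k hk => by
  filter_upwards [(h k hk).eventually_nhds, iterate_dirD_comm hw d e k,
    (analyticAt_iterate_dirD hw e k).eventually_analyticAt] with z hz h1 h2 hσ
  rw [h1]
  have h3 : HasDerivAt (fun s : ℂ => (dirD e)^[k] w (z + s • d)) _ 0 :=
    hasDerivAt_line (t := 0) (by simpa using h2)
  have h4 : (fun s : ℂ => (dirD e)^[k] w (z + s • d)) =ᶠ[𝓝 0] fun _ => 0 := by
    have := (tendsto_line z d 0)
    simp only [zero_smul, add_zero] at this
    filter_upwards [this.eventually hz] with s hs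
    apply hs
    rw [add_sub_right_comm, map_add, map_smul, hd, hσ]; simp
  have h5 := h3.unique ((hasDerivAt_const (0 : ℂ) (0 : ℂ)).congr_of_eventuallyEq h4)
  simpa using h5

/-- Taylor's formula in the direction `e`, uniformly along the line `σ (z - q) = 0`. -/
lemma VanishesTo.isLittleO (he : σ e = 1) (hw : AnalyticAt ℂ w q) (h : VanishesTo σ e q m w) :
    (fun z => w z - (dirD e)^[m] w q / m.factorial * σ (z - q) ^ m) =o[𝓝 q]
      fun z => σ (z - q) ^ m := by
  induction m generalizing w with
  | zero =>
    simp only [Function.iterate_zero, id_eq, Nat.factorial_zero, Nat.cast_one, div_one, pow_zero,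
      mul_one]
    rw [isLittleO_one_iff]
    have := hw.continuousAt.tendsto.sub_const (w q)
    simpa using this
  | succ m ih =>
    have ih' := ih (analyticAt_dirD hw e) (by simpa using h.dirD_transverse)
    rw [isLittleO_iff] at ih' ⊢
    intro ε hε
    have hev := (ih' hε).and ((h 0 (Nat.succ_pos m)).and hw.eventually_analyticAt)
    obtain ⟨r, hr, hball⟩ := Metric.eventually_nhds_iff.1 hev
    have hcont : Continuous fun z : ℂ × ℂ =>
        ‖z - σ (z - q) • e - q‖ + ‖σ (z - q)‖ * ‖e‖ := by fun_prop
    have hlt : ∀ᶠ z in 𝓝 q, ‖z - σ (z - q) • e - q‖ + ‖σ (z - q)‖ * ‖e‖ < r :=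
      hcont.continuousAt.eventually_lt continuousAt_const (by simpa using hr)
    filter_upwards [hlt] with z hz
    set s := σ (z - q) with hs
    set p := z - s • e with hp
    have hσp : σ (p - q) = 0 := by
      rw [hp, sub_right_comm, map_sub, map_smul, he, ← hs]; simp
    have hin : ∀ t : ℂ, ‖t‖ ≤ ‖s‖ → dist (p + t • e) q < r := by
      intro t ht
      rw [dist_eq_norm, add_sub_right_comm]
      calc ‖p - q + t • e‖ ≤ ‖p - q‖ + ‖t‖ * ‖e‖ := by
            rw [← norm_smul]; exact norm_add_le _ _
        _ ≤ ‖p - q‖ + ‖s‖ * ‖e‖ := by gcongr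
        _ < r := hz
    have hσt : ∀ t : ℂ, σ (p + t • e - q) = t := by
      intro t; rw [add_sub_right_comm, map_add, hσp, map_smul, he]; simp
    set a := (dirD e)^[m] (dirD e w) q with ha
    have hder : ∀ t ∈ Metric.closedBall (0 : ℂ) ‖s‖,
        HasDerivWithinAt (fun t : ℂ => w (p + t • e) - a / (m + 1).factorial * t ^ (m + 1))
          (dirD e w (p + t • e) - a / m.factorial * t ^ m) (Metric.closedBall (0 : ℂ) ‖s‖) t := by
      intro t ht
      have ht' : ‖t‖ ≤ ‖s‖ := by simpa using ht
      have h1 := hasDerivAt_line (t := t) (x := p) (v := e) (hball (hin t ht')).2.2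
      have h2 := (hasDerivAt_pow (m + 1) t).const_mul (a / (m + 1).factorial)
      have h3 := (h1.sub h2).hasDerivWithinAt (s := Metric.closedBall (0 : ℂ) ‖s‖)
      refine h3.congr_deriv ?_
      have : ((m + 1 : ℕ) : ℂ) ≠ 0 := Nat.cast_ne_zero.2 (Nat.succ_ne_zero m)
      have : ((m.factorial : ℕ) : ℂ) ≠ 0 := Nat.cast_ne_zero.2 (Nat.factorial_ne_zero m)
      rw [Nat.factorial_succ]; push_cast at *
      field_simp
    have hbound : ∀ t ∈ Metric.closedBall (0 : ℂ) ‖s‖,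
        ‖dirD e w (p + t • e) - a / m.factorial * t ^ m‖ ≤ ε * ‖s‖ ^ m := by
      intro t ht
      have ht' : ‖t‖ ≤ ‖s‖ := by simpa using ht
      have := (hball (hin t ht')).1
      rw [hσt, norm_pow] at this
      exact this.trans (by gcongr)
    have hmv := (convex_closedBall (0 : ℂ) ‖s‖).norm_image_sub_le_of_norm_hasDerivWithin_le
      hder hbound (x := 0) (y := s) (by simp) (by simp)
    have hw0 : w p = 0 := by
      have := (hball (by simpa using hin 0 (by simp) : dist p q < r)).2.1 hσp
      simpa using this
    have hps : p + s • e = z := by rw [hp]; simp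
    simp only [hps, zero_smul, add_zero, hw0, sub_zero] at hmv
    rw [Function.iterate_succ_apply, norm_pow, pow_succ ‖s‖, ← mul_assoc]
    simpa using hmv

/-- A lower bound for the order of vanishing along the line `σ (z - q) = 0`. -/
def OrdGE (σ : ℂ × ℂ →L[ℂ] ℂ) (q : ℂ × ℂ) (m : ℕ) (w : ℂ × ℂ → ℂ) : Prop :=
  w =O[𝓝 q] fun z => σ (z - q) ^ m

lemma ordGE_zero_of_analyticAt (hw : AnalyticAt ℂ w q) : OrdGE σ q 0 w := by
  simpa [OrdGE] using hw.continuousAt.isBigO_one ℂ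

lemma OrdGE.mono (h : OrdGE σ q m w) (hk : k ≤ m) : OrdGE σ q k w := by
  refine h.trans ?_
  obtain ⟨j, rfl⟩ := Nat.exists_eq_add_of_le hk
  have : (fun z => σ (z - q) ^ j) =O[𝓝 q] fun _ => (1 : ℂ) := by
    have : Continuous fun z : ℂ × ℂ => σ (z - q) ^ j := by fun_prop
    exact this.continuousAt.isBigO_one ℂ
  simpa [pow_add] using (isBigO_refl (fun z => σ (z - q) ^ k) (𝓝 q)).mul this

lemma OrdGE.mul (h : OrdGE σ q m u) (h' : OrdGE σ q k w) :
    OrdGE σ q (m + k) fun z => u z * w z := by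
  simpa [OrdGE, pow_add] using IsBigO.mul h h'

lemma OrdGE.add (h : OrdGE σ q m u) (h' : OrdGE σ q m w) :
    OrdGE σ q m fun z => u z + w z := IsBigO.add h h'

lemma OrdGE.sub (h : OrdGE σ q m u) (h' : OrdGE σ q m w) :
    OrdGE σ q m fun z => u z - w z := IsBigO.sub h h'

lemma OrdGE.mul_analyticAt (h : OrdGE σ q m u) (hw : AnalyticAt ℂ w q) :
    OrdGE σ q m fun z => u z * w z := h.mul (ordGE_zero_of_analyticAt hw)

lemma VanishesTo.ordGE (he : σ e = 1) (hw : AnalyticAt ℂ w q) (h : VanishesTo σ e q m w) :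
    OrdGE σ q m w := by
  have h1 := (h.isLittleO he hw).isBigO.add
    (isBigO_const_mul_self ((dirD e)^[m] w q / m.factorial) (fun z => σ (z - q) ^ m) (𝓝 q))
  simpa [OrdGE] using h1

lemma VanishesTo.isBigO_pow (he : σ e = 1) (hw : AnalyticAt ℂ w q) (h : VanishesTo σ e q m w)
    (hm : (dirD e)^[m] w q ≠ 0) : (fun z => σ (z - q) ^ m) =O[𝓝 q] w := by
  have hc : (dirD e)^[m] w q / m.factorial ≠ 0 :=
    div_ne_zero hm (Nat.cast_ne_zero.2 (Nat.factorial_ne_zero m))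
  have h1 : (fun z => w z - (dirD e)^[m] w q / m.factorial * σ (z - q) ^ m) =o[𝓝 q]
      fun z => (dirD e)^[m] w q / m.factorial * σ (z - q) ^ m :=
    (h.isLittleO he hw).trans_isBigO (isBigO_self_const_mul hc _ _)
  have h2 := (show w ~[𝓝 q] _ from h1).isBigO_symm
  exact (isBigO_self_const_mul hc _ _).trans h2

/-- If `u` vanishes to order `m` along a line, the inflection form of a pencil containing `u`
vanishes there to order `3 * m - 2`. -/
lemma VanishesTo.ordGE_infl (he : σ e = 1) (hd : σ d = 0) (hu : AnalyticAt ℂ u q)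
    (hw : AnalyticAt ℂ w q) (hm : 1 ≤ m) (h : VanishesTo σ e q m u) :
    OrdGE σ q (3 * m - 2) (infl d e u w) := by
  have hexp : ∀ v v' : ℂ × ℂ, dirD v (wr v' u w) =ᶠ[𝓝 q] fun z =>
      (dirD v (dirD v' u) z * w z + dirD v' u z * dirD v w z) -
      (dirD v u z * dirD v' w z + u z * dirD v (dirD v' w) z) := by
    intro v v'
    filter_upwards [hu.eventually_analyticAt, hw.eventually_analyticAt] with z h1 h2
    have e1 := dirD_sub (f := fun z => dirD v' u z * w z) (g := fun z => u z * dirD v' w z)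
      ((analyticAt_dirD h1 v').mul h2) (h1.mul (analyticAt_dirD h2 v')) v
    rw [dirD_mul (analyticAt_dirD h1 v') h2, dirD_mul h1 (analyticAt_dirD h2 v')] at e1
    exact e1
  have aw := fun v => analyticAt_dirD hw v
  have au := fun v => analyticAt_dirD hu v
  have hud := h.dirD_tangent hu hd
  have hue := h.dirD_transverse
  have o0 := h.ordGE he hu
  have od := hud.ordGE he (au d)
  have oe := hue.ordGE he (au e)
  have odd := (hud.dirD_tangent (au d) hd).ordGE he (analyticAt_dirD (au d) d)
  have oed := hud.dirD_transverse.ordGE he (analyticAt_dirD (au d) e)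
  have ode := (hue.dirD_tangent (au e) hd).ordGE he (analyticAt_dirD (au e) d)
  have oee := hue.dirD_transverse.ordGE he (analyticAt_dirD (au e) e)
  have A : OrdGE σ q m (wr d u w) :=
    (od.mul_analyticAt hw).sub (o0.mul_analyticAt (aw d))
  have B : OrdGE σ q (m - 1) (wr e u w) :=
    (oe.mul_analyticAt hw).sub ((o0.mono (by omega)).mul_analyticAt (aw e))
  have dA : OrdGE σ q m (dirD d (wr d u w)) :=
    (((odd.mul_analyticAt hw).add (od.mul_analyticAt (aw d))).sub
      ((od.mul_analyticAt (aw d)).add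
        (o0.mul_analyticAt (analyticAt_dirD (aw d) d)))).congr' (hexp d d).symm EventuallyEq.rfl
  have eA : OrdGE σ q (m - 1) (dirD e (wr d u w)) :=
    (((oed.mul_analyticAt hw).add ((od.mono (by omega)).mul_analyticAt (aw e))).sub
      ((oe.mul_analyticAt (aw d)).add ((o0.mono (by omega)).mul_analyticAt
        (analyticAt_dirD (aw d) e)))).congr' (hexp e d).symm EventuallyEq.rfl
  have dB : OrdGE σ q (m - 1) (dirD d (wr e u w)) :=
    (((ode.mul_analyticAt hw).add (oe.mul_analyticAt (aw d))).sub
      (((od.mono (by omega)).mul_analyticAt (aw e)).add ((o0.mono (by omega)).mul_analyticAt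
        (analyticAt_dirD (aw e) d)))).congr' (hexp d e).symm EventuallyEq.rfl
  have eB : OrdGE σ q (m - 1 - 1) (dirD e (wr e u w)) :=
    (((oee.mul_analyticAt hw).add ((oe.mono (by omega)).mul_analyticAt (aw e))).sub
      (((oe.mono (by omega)).mul_analyticAt (aw e)).add ((o0.mono (by omega)).mul_analyticAt
        (analyticAt_dirD (aw e) e)))).congr' (hexp e e).symm EventuallyEq.rfl
  have t1 := (dA.mul (B.mul B)).mono (k := 3 * m - 2) (by omega)
  have t2 := ((eA.add dB).mul (A.mul B)).mono (k := 3 * m - 2) (by omega)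
  have t3 := (eB.mul (A.mul A)).mono (k := 3 * m - 2) (by omega)
  refine IsBigO.congr_left ((t1.sub t2).add t3) fun z => ?_
  simp only [infl, curv, sq]

end ComplexTorus

namespace ComplexTorus

/-! ### Holomorphic functions on lines and discs -/

/-- Riemann's theorem on removable singularities, for all the singularities in `U` at once. -/
lemma exists_analyticOnNhd_extension {h : ℂ → ℂ} {U : Set ℂ} (hm : MeromorphicOn h U)
    (hb : ∀ t ∈ U, ∃ M : ℝ, ∀ᶠ s in 𝓝[≠] t, ‖h s‖ ≤ M) :
    ∃ g : ℂ → ℂ, AnalyticOnNhd ℂ g U ∧ (∀ t ∈ U, g =ᶠ[𝓝[≠] t] h) ∧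
      ∀ t ∈ U, ContinuousAt h t → g t = h t := by
  have hg : AnalyticOnNhd ℂ (toMeromorphicNFOn h U) U := by
    intro t ht
    rw [← (meromorphicNFOn_toMeromorphicNFOn h U ht).meromorphicOrderAt_nonneg_iff_analyticAt,
      meromorphicOrderAt_toMeromorphicNFOn hm ht]
    by_contra hneg
    have h1 := tendsto_cobounded_of_meromorphicOrderAt_neg (not_le.1 hneg)
    obtain ⟨M, hM⟩ := hb t ht
    have h2 := (tendsto_norm_atTop_iff_cobounded.2 h1).eventually_gt_atTop M
    obtain ⟨s, hs1, hs2⟩ := (hM.and h2).exists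
    exact absurd hs1 (not_le.2 hs2)
  have heq : ∀ t ∈ U, toMeromorphicNFOn h U =ᶠ[𝓝[≠] t] h := fun t ht =>
    hm.toMeromorphicNFOn_eq_self_on_nhdsNE ht
  refine ⟨_, hg, heq, fun t ht hc => ?_⟩
  exact tendsto_nhds_unique
    (((hg t ht).continuousAt.tendsto.mono_left nhdsWithin_le_nhds).congr' (heq t ht))
    (hc.tendsto.mono_left nhdsWithin_le_nhds)

/-- The maximum principle on a disc, for a function with removable singularities. -/
lemma norm_le_of_sphere {h : ℂ → ℂ} {R M : ℝ} (hR : 0 < R)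
    (hm : MeromorphicOn h (Metric.closedBall 0 R))
    (hb : ∀ t ∈ Metric.closedBall (0 : ℂ) R, ∃ M : ℝ, ∀ᶠ s in 𝓝[≠] t, ‖h s‖ ≤ M)
    (hs : ∀ t ∈ Metric.sphere (0 : ℂ) R, ContinuousAt h t ∧ ‖h t‖ ≤ M) (h0 : ContinuousAt h 0) :
    ‖h 0‖ ≤ M := by
  obtain ⟨g, hg, -, hgh⟩ := exists_analyticOnNhd_extension hm hb
  rw [← hgh 0 (by simp [hR.le]) h0]
  refine Complex.norm_le_of_forall_mem_frontier_norm_le (U := Metric.ball (0 : ℂ) R)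
    Metric.isBounded_ball ?_ ?_ (subset_closure (by simp [hR]))
  · exact hg.differentiableOn.diffContOnCl_ball subset_rfl
  · intro t ht
    rw [frontier_ball _ hR.ne'] at ht
    rw [hgh t (Metric.sphere_subset_closedBall ht) (hs t ht).1]
    exact (hs t ht).2

/-- Liouville's theorem for a function with removable singularities. -/
lemma eq_of_bounded {h : ℂ → ℂ} {M : ℝ} (hm : MeromorphicOn h Set.univ)
    (hb : ∀ t, ∀ᶠ s in 𝓝[≠] t, ‖h s‖ ≤ M) {t₁ t₂ : ℂ} (h₁ : ContinuousAt h t₁)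
    (h₂ : ContinuousAt h t₂) : h t₁ = h t₂ := by
  obtain ⟨g, hg, hgh, hgc⟩ := exists_analyticOnNhd_extension hm fun t _ => ⟨M, hb t⟩
  rw [← hgc t₁ trivial h₁, ← hgc t₂ trivial h₂]
  refine Differentiable.apply_eq_apply_of_bounded
    (fun t => (hg t trivial).differentiableAt) ?_ t₁ t₂
  rw [isBounded_iff_forall_norm_le]
  refine ⟨M, ?_⟩
  rintro _ ⟨t, rfl⟩
  refine le_of_tendsto (x := 𝓝[≠] t) (((hg t trivial).continuousAt.tendsto.mono_left
    nhdsWithin_le_nhds).norm) ?_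
  filter_upwards [hgh t trivial, hb t] with s h1 h2
  rwa [h1]

lemma countable_of_forall_eventually_notMem {B : Set ℂ} (h : ∀ t, ∀ᶠ s in 𝓝[≠] t, s ∉ B) :
    B.Countable := by
  have h' : ∀ t, {s | s ≠ t → s ∉ B} ∈ 𝓝 t := fun t => eventually_nhdsWithin_iff.1 (h t)
  obtain ⟨S, hS, hU⟩ := TopologicalSpace.countable_cover_nhds h'
  refine hS.mono fun t ht => ?_
  have : t ∈ ⋃ x ∈ S, {s | s ≠ x → s ∉ B} := hU ▸ Set.mem_univ t
  simp only [Set.mem_iUnion, Set.mem_ofPred_eq] at this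
  obtain ⟨x, hx, htx⟩ := this
  by_cases htx' : t = x
  · rwa [htx']
  · exact absurd ht (htx htx')

/-- Uniqueness for the linear differential equation `b * y' = k * y`. -/
lemma eventually_eq_zero_of_deriv {y b k : ℂ → ℂ} (hy : AnalyticAt ℂ y 0) (hb : AnalyticAt ℂ b 0)
    (hk : AnalyticAt ℂ k 0) (hb0 : b 0 ≠ 0) (hy0 : y 0 = 0)
    (h : ∀ᶠ t in 𝓝 0, b t * deriv y t = k t * y t) : ∀ᶠ t in 𝓝 0, y t = 0 := by
  by_contra hne
  obtain ⟨n, g, hg, hg0, hyg⟩ := hy.exists_eventuallyEq_pow_smul_nonzero_iff.2 hne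
  simp only [sub_zero, smul_eq_mul] at hyg
  cases n with
  | zero => exact hg0 (by simpa [hy0] using hyg.self_of_nhds.symm)
  | succ n =>
    -- after division by `t ^ n` the equation reads `b ((n + 1) g + t g') = t k g`
    have h1 : ∀ᶠ t in 𝓝[≠] (0 : ℂ), b t * ((n + 1) * g t + t * deriv g t) = k t * (t * g t) := by
      have hyg' := hyg.eventually_nhds
      rw [eventually_nhdsWithin_iff]
      filter_upwards [h, hyg', hg.eventually_analyticAt] with t ht hyt hgt ht0
      have hd : deriv y t = (n + 1) * t ^ n * g t + t ^ (n + 1) * deriv g t := by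
        have e1 : y =ᶠ[𝓝 t] fun s => s ^ (n + 1) * g s := hyt
        rw [e1.deriv_eq]
        have := (hasDerivAt_pow (n + 1) t).fun_mul hgt.differentiableAt.hasDerivAt
        simpa using this.deriv
      rw [hd, hyt.self_of_nhds] at ht
      have htn : t ^ n ≠ 0 := pow_ne_zero _ ht0
      apply mul_left_cancel₀ htn
      rw [pow_succ] at ht
      linear_combination ht
    have c1 : ContinuousAt (fun t => b t * ((n + 1) * g t + t * deriv g t)) 0 := by
      have := hg.deriv.continuousAt
      have := hg.continuousAt
      have := hb.continuousAt
      fun_prop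
    have c2 : ContinuousAt (fun t => k t * (t * g t)) 0 := by
      have := hg.continuousAt
      have := hk.continuousAt
      fun_prop
    have := tendsto_nhds_unique
      ((c1.tendsto.mono_left nhdsWithin_le_nhds).congr' h1) (c2.tendsto.mono_left nhdsWithin_le_nhds)
    simp only [zero_mul, add_zero, mul_zero, mul_eq_zero] at this
    rcases this with h | h | h
    · exact hb0 h
    · exact (Nat.cast_add_one_ne_zero n) h
    · exact hg0 h

/-! ### Zeros of holomorphic functions of two variables -/

/-- A holomorphic germ that is not zero is not zero on some line. -/
lemma exists_line_eventually_ne_zero {h : ℂ × ℂ → ℂ} {p : ℂ × ℂ} (hh : AnalyticAt ℂ h p)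
    (hne : ¬ ∀ᶠ x in 𝓝 p, h x = 0) :
    ∃ e : ℂ × ℂ, e ≠ 0 ∧ ∀ᶠ t : ℂ in 𝓝[≠] 0, h (p + t • e) ≠ 0 := by
  by_cases hp : h p = 0
  swap
  · refine ⟨(1, 0), by simp, eventually_nhdsWithin_of_eventually_nhds ?_⟩
    have := tendsto_line p (1, 0) 0
    simp only [zero_smul, add_zero] at this
    exact this.eventually (hh.continuousAt.eventually_ne hp)
  obtain ⟨r, hr, hball⟩ := Metric.eventually_nhds_iff.1 hh.eventually_analyticAt
  obtain ⟨x, hx, hxne⟩ : ∃ x ∈ Metric.ball p r, h x ≠ 0 := by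
    by_contra! hcon
    exact hne (Filter.mem_of_superset (Metric.ball_mem_nhds p hr) hcon)
  set e := x - p with he
  have hconv : IsPreconnected ((fun t : ℂ => p + t • e) ⁻¹' Metric.ball p r) := by
    apply Convex.isPreconnected
    intro s hs t ht a b ha hb hab
    have := convex_ball p r hs ht ha hb hab
    simp only [Set.mem_preimage] at *
    convert this using 1
    rw [smul_add, smul_add, add_add_add_comm, ← add_smul, hab, one_smul, add_smul, smul_assoc,
      smul_assoc]
  have han : AnalyticOnNhd ℂ (fun t : ℂ => h (p + t • e))
      ((fun t : ℂ => p + t • e) ⁻¹' Metric.ball p r) := fun t ht =>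
    analyticAt_line (hball ht)
  have h0 : (0 : ℂ) ∈ (fun t : ℂ => p + t • e) ⁻¹' Metric.ball p r := by simp [hr]
  have h1 : (1 : ℂ) ∈ (fun t : ℂ => p + t • e) ⁻¹' Metric.ball p r := by simpa [he] using hx
  rcases (han 0 h0).eventually_eq_zero_or_eventually_ne_zero with hz | hz
  · have := han.eqOn_zero_of_preconnected_of_eventuallyEq_zero hconv h0 hz h1
    exact absurd (by simpa [he] using this) hxne
  · refine ⟨e, fun he0 => hxne ?_, hz⟩
    rw [sub_eq_zero.1 (he.symm.trans he0), hp]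

lemma exists_cross_ne_zero {e : ℂ × ℂ} (he : e ≠ 0) : ∃ d, cross e d ≠ 0 := by
  by_contra! h
  have h1 := h (0, 1)
  have h2 := h (1, 0)
  simp only [cross, mul_one, mul_zero, sub_zero, zero_sub, neg_eq_zero] at h1 h2
  exact he (Prod.ext h1 h2)

/-- A property that holds near the circle `p + t • e`, `‖t‖ = R`, holds near all the circles with
a centre close to `p`. -/
lemma eventually_forall_of_isCompact {P : ℂ × ℂ → Prop} {K : Set ℂ} (hK : IsCompact K)
    {p e : ℂ × ℂ} (h : ∀ t ∈ K, ∀ᶠ x in 𝓝 (p + t • e), P x) :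
    ∀ᶠ z in 𝓝 p, ∀ t ∈ K, P (z + t • e) := by
  refine hK.eventually_forall_of_forall_eventually fun t ht => ?_
  have : Tendsto (fun y : (ℂ × ℂ) × ℂ => y.1 + y.2 • e) (𝓝 (p, t)) (𝓝 (p + t • e)) :=
    Continuous.tendsto (by fun_prop) (p, t)
  exact this.eventually (h t ht)

lemma not_countable_of_mem_nhds {N : Set ℂ} {t : ℂ} (hN : N ∈ 𝓝 t) : ¬ N.Countable := fun h => by
  have := (h.dense_compl ℂ).inter_nhds_nonempty hN
  obtain ⟨s, hs, hs'⟩ := this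
  exact hs hs'

/-- The zeros of a holomorphic function of two variables are not isolated: near each zero there
are uncountably many. -/
lemma not_countable_zeros {h : ℂ × ℂ → ℂ} {p : ℂ × ℂ} (hh : AnalyticAt ℂ h p) (hp : h p = 0)
    {N : Set (ℂ × ℂ)} (hN : N ∈ 𝓝 p) : ¬ {x | x ∈ N ∧ h x = 0}.Countable := by
  intro hcount
  by_cases hz : ∀ᶠ x in 𝓝 p, h x = 0
  · have hcont : Tendsto (fun s : ℂ => p + s • ((1, 0) : ℂ × ℂ)) (𝓝 0) (𝓝 p) := by
      simpa using tendsto_line p (1, 0) 0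
    have hinj : Function.Injective (fun s : ℂ => p + s • ((1, 0) : ℂ × ℂ)) := by
      intro s t hst
      simpa using congrArg Prod.fst hst
    exact not_countable_of_mem_nhds (hcont.eventually ((show ∀ᶠ x in 𝓝 p, x ∈ N from hN).and hz)) (hcount.preimage hinj)
  obtain ⟨e, he, hline⟩ := exists_line_eventually_ne_zero hh hz
  obtain ⟨d, hd⟩ := exists_cross_ne_zero he
  have hcont : Tendsto (fun s : ℂ => p + s • e) (𝓝 0) (𝓝 p) := by simpa using tendsto_line p e 0
  have hgood : ∀ᶠ x in 𝓝 p, ∀ᶠ y in 𝓝 x, y ∈ N ∧ AnalyticAt ℂ h y :=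
    ((show ∀ᶠ x in 𝓝 p, x ∈ N from hN).and hh.eventually_analyticAt).eventually_nhds
  obtain ⟨R, hR, hRb⟩ := Metric.nhds_basis_closedBall.eventually_iff.1
    ((hcont.eventually hgood).and (eventually_nhdsWithin_iff.1 hline))
  have hsph : ∀ t ∈ Metric.sphere (0 : ℂ) R, h (p + t • e) ≠ 0 := fun t ht =>
    (hRb (Metric.sphere_subset_closedBall ht)).2 (by
      rintro rfl; simp [hR.ne] at ht)
  -- a lower bound for `h` on the circle, and hence near it
  obtain ⟨μ, hμ, hμb⟩ : ∃ μ > 0, ∀ t ∈ Metric.sphere (0 : ℂ) R, μ < ‖h (p + t • e)‖ := by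
    have hc : ContinuousOn (fun t : ℂ => ‖h (p + t • e)‖) (Metric.sphere (0 : ℂ) R) := fun t ht =>
      (analyticAt_line (hRb (Metric.sphere_subset_closedBall ht)).1.self_of_nhds.2).continuousAt
        |>.norm.continuousWithinAt
    obtain ⟨t₀, ht₀, hmin⟩ := (isCompact_sphere (0 : ℂ) R).exists_isMinOn
      (NormedSpace.sphere_nonempty.2 hR.le) hc
    refine ⟨‖h (p + t₀ • e)‖ / 2, half_pos (norm_pos_iff.2 (hsph t₀ ht₀)), fun t ht => ?_⟩
    have h1 := hmin ht
    have h2 := norm_pos_iff.2 (hsph t₀ ht₀)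
    simp only [Set.mem_ofPred_eq] at h1
    linarith
  have e1 := eventually_forall_of_isCompact (P := fun y => y ∈ N ∧ AnalyticAt ℂ h y)
    (isCompact_closedBall (0 : ℂ) R) (p := p) (e := e) fun t ht => (hRb ht).1
  have e2 := eventually_forall_of_isCompact (P := fun y => μ < ‖h y‖)
    (isCompact_sphere (0 : ℂ) R) (p := p) (e := e) fun t ht =>
      (continuousAt_const.eventually_lt
        (hRb (Metric.sphere_subset_closedBall ht)).1.self_of_nhds.2.continuousAt.norm (hμb t ht))
  have e3 : ∀ᶠ z in 𝓝 p, ‖h z‖ < μ :=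
    hh.continuousAt.norm.eventually_lt continuousAt_const (by simpa [hp] using hμ)
  have hzero : ∀ᶠ z in 𝓝 p, ∃ t : ℂ, z + t • e ∈ N ∧ h (z + t • e) = 0 := by
    filter_upwards [e1, e2, e3] with z h1 h2 h3
    by_contra! hcon
    have hnz : ∀ t ∈ Metric.closedBall (0 : ℂ) R, h (z + t • e) ≠ 0 := fun t ht =>
      hcon t (h1 t ht).1
    have han : AnalyticOnNhd ℂ (fun t : ℂ => (h (z + t • e))⁻¹) (Metric.closedBall 0 R) :=
      fun t ht => (analyticAt_line (h1 t ht).2).inv (hnz t ht)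
    have := Complex.norm_le_of_forall_mem_frontier_norm_le (U := Metric.ball (0 : ℂ) R) (C := μ⁻¹)
      Metric.isBounded_ball (han.differentiableOn.diffContOnCl_ball subset_rfl) (fun t ht => by
        rw [frontier_ball _ hR.ne'] at ht
        rw [norm_inv]
        exact inv_anti₀ hμ (h2 t ht).le) (z := 0) (subset_closure (by simp [hR]))
    simp only [zero_smul, add_zero, norm_inv] at this
    have h0 : 0 < ‖h z‖ := norm_pos_iff.2 (by simpa using hnz 0 (by simp [hR.le]))
    exact absurd ((inv_le_inv₀ h0 hμ).1 this) (not_le.2 h3)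
  have hcont' : Tendsto (fun s : ℂ => p + s • d) (𝓝 0) (𝓝 p) := by simpa using tendsto_line p d 0
  refine not_countable_of_mem_nhds (hcont'.eventually hzero)
    ((hcount.image fun x => cross e (x - p) / cross e d).mono ?_)
  rintro s ⟨t, ht, hht⟩
  refine ⟨_, ⟨ht, hht⟩, ?_⟩
  rw [div_eq_iff hd]
  simp [cross]
  ring

end ComplexTorus

namespace ComplexTorus

/-! ### Members of the pencil and their zero sets -/

/-- The local equation `f * b - g * a` of the fiber over `c = [a : b]`. -/
noncomputable def member (c : P1) (f g : ℂ × ℂ → ℂ) : ℂ × ℂ → ℂ :=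
  fun x => f x * c.rep.2 - g x * c.rep.1

lemma mk_rep' (c : P1) : Projectivization.mk ℂ (c.rep.1, c.rep.2) c.rep_nonzero = c := c.mk_rep

lemma mk_eq_of_cross_eq_zero {v w : ℂ × ℂ} (hv : v ≠ 0) (hw : w ≠ 0) (h : cross v w = 0) :
    Projectivization.mk ℂ v hv = Projectivization.mk ℂ w hw := by
  rw [Projectivization.mk_eq_mk_iff']
  obtain ⟨d, hd⟩ := exists_cross_ne_zero hw
  refine ⟨cross v d / cross w d, ?_⟩
  have h1 := cross_smul_eq w d v
  have h2 : cross w v = 0 := by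
    simp only [cross] at h ⊢; linear_combination -h
  rw [h2, zero_smul, add_zero] at h1
  rw [div_eq_inv_mul, mul_smul, ← h1, smul_smul, inv_mul_cancel₀ hd, one_smul]

lemma cross_rep_ne_zero {c c' : P1} (h : c ≠ c') : cross c.rep c'.rep ≠ 0 := fun h0 =>
  h (by simpa using mk_eq_of_cross_eq_zero c.rep_nonzero c'.rep_nonzero h0)

variable {f g : ℂ × ℂ → ℂ} {p q x d : ℂ × ℂ} {c c' : P1}

lemma analyticAt_member (hf : AnalyticAt ℂ f p) (hg : AnalyticAt ℂ g p) (c : P1) :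
    AnalyticAt ℂ (member c f g) p :=
  (hf.mul analyticAt_const).sub (hg.mul analyticAt_const)

lemma eq_zero_of_member_eq_zero (h : c ≠ c') (h1 : member c f g x = 0)
    (h2 : member c' f g x = 0) : f x = 0 ∧ g x = 0 := by
  have hd := cross_rep_ne_zero h
  simp only [member, cross] at *
  constructor
  · apply mul_left_cancel₀ hd
    linear_combination c.rep.1 * h2 - c'.rep.1 * h1
  · apply mul_left_cancel₀ hd
    linear_combination c.rep.2 * h2 - c'.rep.2 * h1

namespace IsLocalRep

variable {Λ : Submodule ℤ (ℂ × ℂ)} {Γ : Set (Torus Λ × P1)}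

lemma analyticAt_member (h : IsLocalRep Γ p f g) (c : P1) : AnalyticAt ℂ (member c f g) p :=
  ComplexTorus.analyticAt_member h.analytic_left h.analytic_right c

/-- A reduced representation at `p` is also one at the nearby points. -/
lemma eventually (h : IsLocalRep Γ p f g) : ∀ᶠ x in 𝓝 p, IsLocalRep Γ x f g := by
  filter_upwards [h.analytic_left.eventually_analyticAt, h.analytic_right.eventually_analyticAt,
    (eventually_nhdsWithin_iff.1 h.isolated).eventually_nhds,
    h.mem_graph_iff.eventually_nhds] with x h1 h2 h3 h4
  refine ⟨h1, h2, ?_, h4⟩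
  by_cases hx : x = p
  · rw [hx]; exact h.isolated
  · filter_upwards [eventually_nhdsWithin_of_eventually_nhds h3,
      eventually_nhdsWithin_of_eventually_nhds (isOpen_ne.mem_nhds hx)] with y h5 h6
    exact h5 h6

end IsLocalRep

namespace MeromorphicMap

variable {Λ : Submodule ℤ (ℂ × ℂ)} (F : MeromorphicMap Λ)

/-- The preimage in `ℂ²` of the fiber over `c`. -/
def zeroSet (c : P1) : Set (ℂ × ℂ) := {x | (proj Λ x, c) ∈ F.graph}

variable {F}

lemma mem_zeroSet_iff (h : IsLocalRep F.graph x f g) (c : P1) :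
    x ∈ F.zeroSet c ↔ member c f g x = 0 := by
  have := h.mem_graph_iff.self_of_nhds c.rep.1 c.rep.2 c.rep_nonzero
  rw [mk_rep'] at this
  rw [member, sub_eq_zero]
  exact this

lemma eventually_mem_zeroSet_iff (h : IsLocalRep F.graph p f g) (c : P1) :
    ∀ᶠ x in 𝓝 p, x ∈ F.zeroSet c ↔ member c f g x = 0 :=
  h.eventually.mono fun _ hx => mem_zeroSet_iff hx c

variable (F) in
lemma isClosed_zeroSet (c : P1) : IsClosed (F.zeroSet c) := by
  rw [← isOpen_compl_iff, isOpen_iff_eventually]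
  intro p hp
  obtain ⟨f, g, h⟩ := F.exists_localRep p
  have : member c f g p ≠ 0 := fun h0 => hp ((mem_zeroSet_iff h c).2 h0)
  filter_upwards [eventually_mem_zeroSet_iff h c,
    (h.analyticAt_member c).continuousAt.eventually_ne this] with x h1 h2 h3
  exact h2 (h1.1 h3)

lemma add_mem_zeroSet_iff {l : ℂ × ℂ} (hl : l ∈ Λ) : x + l ∈ F.zeroSet c ↔ x ∈ F.zeroSet c := by
  have : proj Λ (x + l) = proj Λ x := by
    rw [proj, proj, Submodule.Quotient.eq]; simpa using hl
  simp only [zeroSet, Set.mem_ofPred_eq, this]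

variable (F) in
lemma line_dichotomy (c : P1) (x d : ℂ × ℂ) (t : ℂ) :
    (∀ᶠ s in 𝓝 t, x + s • d ∈ F.zeroSet c) ∨ ∀ᶠ s in 𝓝[≠] t, x + s • d ∉ F.zeroSet c := by
  obtain ⟨f, g, h⟩ := F.exists_localRep (x + t • d)
  have h1 := (tendsto_line x d t).eventually (eventually_mem_zeroSet_iff h c)
  rcases (analyticAt_line (h.analyticAt_member c)).eventually_eq_zero_or_eventually_ne_zero
    with h2 | h2
  · left
    filter_upwards [h1, h2] with s h3 h4 using h3.2 h4
  · right
    filter_upwards [eventually_nhdsWithin_of_eventually_nhds h1, h2] with s h3 h4 h5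
    exact h4 (h3.1 h5)

/-- The identity theorem on a complex line. -/
lemma line_subset_zeroSet {t₀ : ℂ} (h : ∃ᶠ t in 𝓝[≠] t₀, x + t • d ∈ F.zeroSet c) (t : ℂ) :
    x + t • d ∈ F.zeroSet c := by
  let S : Set ℂ := {t | ∀ᶠ s in 𝓝 t, x + s • d ∈ F.zeroSet c}
  have hS : IsClopen S := by
    constructor
    · rw [← isOpen_compl_iff, isOpen_iff_eventually]
      intro t ht
      have h1 := (F.line_dichotomy c x d t).resolve_left ht
      rw [eventually_nhdsWithin_iff] at h1
      filter_upwards [h1] with s hs hsS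
      by_cases hst : s = t
      · exact ht (hst ▸ hsS)
      · exact hs hst (show ∀ᶠ r in 𝓝 s, x + r • d ∈ F.zeroSet c from hsS).self_of_nhds
    · rw [isOpen_iff_eventually]
      exact fun t ht => Eventually.eventually_nhds ht
  have ht₀ : t₀ ∈ S := (F.line_dichotomy c x d t₀).resolve_right h
  have : ∀ᶠ r in 𝓝 t, x + r • d ∈ F.zeroSet c := by
    change t ∈ S
    rw [hS.eq_univ ⟨t₀, ht₀⟩]; trivial
  exact this.self_of_nhds

/-- The identity theorem for the fibers of a meromorphic map. -/
lemma zeroSet_eq_univ (h : ∀ᶠ y in 𝓝 x, y ∈ F.zeroSet c) : F.zeroSet c = Set.univ := by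
  refine Set.eq_univ_of_forall fun y => ?_
  have h1 : ∀ᶠ t : ℂ in 𝓝 0, x + t • (y - x) ∈ F.zeroSet c :=
    (by simpa using tendsto_line x (y - x) 0 :
      Tendsto (fun t : ℂ => x + t • (y - x)) (𝓝 0) (𝓝 x)).eventually h
  simpa using line_subset_zeroSet (eventually_nhdsWithin_of_eventually_nhds h1).frequently 1

lemma eventually_notMem_line (h : ∃ t : ℂ, x + t • d ∉ F.zeroSet c) (t : ℂ) :
    ∀ᶠ s in 𝓝[≠] t, x + s • d ∉ F.zeroSet c := by
  by_contra hcon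
  obtain ⟨s, hs⟩ := h
  exact hs (line_subset_zeroSet hcon s)

variable (F) in
/-- A meromorphic map is nonconstant when no fiber is everything. -/
def Nonconst : Prop := ∀ c, F.zeroSet c ≠ Set.univ

lemma Nonconst.exists_notMem (hF : F.Nonconst) (c : P1) : ∃ x, x ∉ F.zeroSet c :=
  (Set.ne_univ_iff_exists_notMem _).1 (hF c)

lemma Nonconst.dense_compl (hF : F.Nonconst) (c : P1) : Dense (F.zeroSet c)ᶜ := by
  rw [← interior_eq_empty_iff_dense_compl, Set.eq_empty_iff_forall_notMem]
  exact fun x hx => hF c (zeroSet_eq_univ (mem_interior_iff_mem_nhds.1 hx))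

end MeromorphicMap

/-! ### The local structure of a linear fiber -/

/-- The linear form `cross v`. -/
noncomputable def crossL (v : ℂ × ℂ) : ℂ × ℂ →L[ℂ] ℂ :=
  v.1 • ContinuousLinearMap.snd ℂ ℂ ℂ - v.2 • ContinuousLinearMap.fst ℂ ℂ ℂ

@[simp] lemma crossL_apply (v w : ℂ × ℂ) : crossL v w = cross v w := by
  simp [crossL, cross]

lemma exists_eq_smul_of_cross_eq_zero {l x : ℂ × ℂ} (hl : l ≠ 0) (h : cross l x = 0) :
    ∃ t : ℂ, x = t • l := by
  obtain ⟨d, hd⟩ := exists_cross_ne_zero hl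
  refine ⟨cross x d / cross l d, ?_⟩
  have h1 := cross_smul_eq l d x
  rw [h, zero_smul, add_zero] at h1
  rw [div_eq_inv_mul, mul_smul, ← h1, smul_smul, inv_mul_cancel₀ hd, one_smul]

lemma eventually_iterate_deriv_line {u : ℂ × ℂ → ℂ} (hu : AnalyticAt ℂ u q) (e : ℂ × ℂ) (n : ℕ) :
    ∀ᶠ t in 𝓝 (0 : ℂ), deriv^[n] (fun s : ℂ => u (q + s • e)) t = (dirD e)^[n] u (q + t • e) := by
  have h0 : Tendsto (fun s : ℂ => q + s • e) (𝓝 0) (𝓝 q) := by simpa using tendsto_line q e 0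
  induction n with
  | zero => simp
  | succ n ih =>
    filter_upwards [ih.eventually_nhds,
      h0.eventually (analyticAt_iterate_dirD hu e n).eventually_analyticAt] with t ht hat
    rw [Function.iterate_succ_apply', Function.iterate_succ_apply',
      (show deriv^[n] (fun s : ℂ => u (q + s • e)) =ᶠ[𝓝 t] _ from ht).deriv_eq]
    exact (hasDerivAt_line hat).deriv

lemma exists_iterate_dirD_ne_zero {u : ℂ × ℂ → ℂ} {e : ℂ × ℂ} (hu : AnalyticAt ℂ u q)
    (h : ¬ ∀ᶠ t in 𝓝 (0 : ℂ), u (q + t • e) = 0) : ∃ n, (dirD e)^[n] u q ≠ 0 := by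
  by_contra! hcon
  apply h
  have han : AnalyticAt ℂ (fun t : ℂ => u (q + t • e)) 0 := analyticAt_line (by simpa using hu)
  have hs := han.hasFPowerSeriesAt
  have hzero : (FormalMultilinearSeries.ofScalars ℂ
      (fun n => iteratedDeriv n (fun t : ℂ => u (q + t • e)) 0 / n.factorial)) = 0 := by
    ext n
    have := (eventually_iterate_deriv_line hu e n).self_of_nhds
    rw [← iteratedDeriv_eq_iterate] at this
    simp [FormalMultilinearSeries.ofScalars, this, hcon]
  rw [hzero] at hs
  exact hs.eventually_eq_zero

namespace MeromorphicMap

variable {Λ : Submodule ℤ (ℂ × ℂ)} (F : MeromorphicMap Λ)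

/-- Near `q`, the fiber over `c` looks like a line with some multiplicity `m`: its equation is
bounded below by the `m`-th power of a linear form `σ`, and the inflection form vanishes to order
`3 * m - 2` along `σ = 0`. -/
def IsGood (c : P1) (q : ℂ × ℂ) : Prop :=
  ∃ (f g : ℂ × ℂ → ℂ) (σ : ℂ × ℂ →L[ℂ] ℂ) (m : ℕ), IsLocalRep F.graph q f g ∧
    (f q ≠ 0 ∨ g q ≠ 0) ∧ σ ≠ 0 ∧ 1 ≤ m ∧
    ((fun z => σ (z - q) ^ m) =O[𝓝 q] member c f g) ∧
    OrdGE σ q (3 * m - 2) (infl (1, 0) (0, 1) f g)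

variable {F}

lemma ordGE_infl_of_vanishesTo {σ : ℂ × ℂ →L[ℂ] ℂ} {l e : ℂ × ℂ} {m : ℕ}
    (h : IsLocalRep F.graph q f g) (he : σ e = 1) (hl : σ l = 0) (hle : cross l e ≠ 0)
    (hm : 1 ≤ m) (hv : VanishesTo σ e q m (member c f g)) :
    OrdGE σ q (3 * m - 2) (infl (1, 0) (0, 1) f g) := by
  set a := c.rep.1 with ha
  set b := c.rep.2 with hb
  -- complete `b f - a g` to a basis of the pencil by its Hermitian-orthogonal member
  set w : ℂ × ℂ → ℂ := fun x => f x * (starRingEnd ℂ a) - g x * (-(starRingEnd ℂ b)) with hw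
  have haw : AnalyticAt ℂ w q :=
    (h.analytic_left.mul analyticAt_const).sub (h.analytic_right.mul analyticAt_const)
  have h1 := hv.ordGE_infl he hl (h.analyticAt_member c) haw hm
  have hdet : a * (starRingEnd ℂ a) - (-(starRingEnd ℂ b)) * b ≠ 0 := by
    intro h0
    have h2 : ((Complex.normSq a + Complex.normSq b : ℝ) : ℂ) = 0 := by
      push_cast
      rw [← Complex.mul_conj, ← Complex.mul_conj]
      linear_combination h0
    have h3 : Complex.normSq a + Complex.normSq b = 0 := by exact_mod_cast h2
    have h4 : a = 0 := Complex.normSq_eq_zero.1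
      (by linarith [Complex.normSq_nonneg a, Complex.normSq_nonneg b])
    have h5 : b = 0 := Complex.normSq_eq_zero.1
      (by linarith [Complex.normSq_nonneg a, Complex.normSq_nonneg b])
    exact c.rep_nonzero (Prod.ext h4 h5)
  set D := (a * (starRingEnd ℂ a) - (-(starRingEnd ℂ b)) * b) ^ 3 * cross l e ^ 2 with hD
  have hD0 : D ≠ 0 := mul_ne_zero (pow_ne_zero _ hdet) (pow_ne_zero _ hle)
  refine (h1.mul_analyticAt (w := fun _ => D⁻¹) analyticAt_const).congr' ?_ EventuallyEq.rfl
  filter_upwards [h.analytic_left.eventually_analyticAt,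
    h.analytic_right.eventually_analyticAt] with z h2 h3
  have h4 : infl l e (member c f g) w z = _ :=
    infl_linear h2 h3 a b (-(starRingEnd ℂ b)) (starRingEnd ℂ a)
  rw [h4, infl_frame h2 h3 l e, ← mul_assoc, ← hD]
  field_simp

/-- If a fiber contains a line, it is a multiple line near all but isolated points of it. -/
lemma eventually_isGood_of_line (hF : F.Nonconst) {l : ℂ × ℂ} (hl : l ≠ 0)
    (h : ∀ t : ℂ, q + t • l ∈ F.zeroSet c) :
    ∀ᶠ t : ℂ in 𝓝[≠] 0, F.IsGood c (q + t • l) := by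
  obtain ⟨y, hy⟩ := hF.exists_notMem c
  set e := y - q with he
  have hqe : q + (1 : ℂ) • e ∉ F.zeroSet c := by simpa [he] using hy
  have hle : cross l e ≠ 0 := fun h0 => by
    obtain ⟨t, ht⟩ := exists_eq_smul_of_cross_eq_zero hl h0
    exact hqe (by simpa [ht] using h t)
  set σ : ℂ × ℂ →L[ℂ] ℂ := (cross l e)⁻¹ • crossL l with hσ
  have hσe : σ e = 1 := by simp [hσ, hle]
  have hσl : σ l = 0 := by simp [hσ, cross, mul_comm]
  obtain ⟨f, g, hrep⟩ := F.exists_localRep q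
  set u := member c f g with hu
  have hau : AnalyticAt ℂ u q := hrep.analyticAt_member c
  have htl : Tendsto (fun s : ℂ => q + s • l) (𝓝 0) (𝓝 q) := by simpa using tendsto_line q l 0
  have hte : Tendsto (fun s : ℂ => q + s • e) (𝓝 0) (𝓝 q) := by simpa using tendsto_line q e 0
  have hex : ∃ k, ¬ ∀ᶠ t in 𝓝 (0 : ℂ), (dirD e)^[k] u (q + t • l) = 0 := by
    obtain ⟨n, hn⟩ := exists_iterate_dirD_ne_zero (e := e) hau (fun h0 => by
      have h1 : ∀ᶠ t in 𝓝[≠] (0 : ℂ), q + t • e ∈ F.zeroSet c :=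
        eventually_nhdsWithin_of_eventually_nhds (by
          filter_upwards [h0, hte.eventually (eventually_mem_zeroSet_iff hrep c)] with t h2 h3
            using h3.2 h2)
      exact hqe (line_subset_zeroSet h1.frequently 1))
    exact ⟨n, fun h0 => hn (by simpa using h0.self_of_nhds)⟩
  classical
  set m := Nat.find hex with hm
  have hm1 : 1 ≤ m := by
    rw [Nat.one_le_iff_ne_zero]
    intro h0
    have := Nat.find_spec hex
    rw [← hm, h0] at this
    apply this
    filter_upwards [htl.eventually (eventually_mem_zeroSet_iff hrep c)] with t ht
    exact ht.1 (h t)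
  have hlt : ∀ᶠ t in 𝓝 (0 : ℂ), ∀ k ∈ Set.Iio m, (dirD e)^[k] u (q + t • l) = 0 := by
    rw [eventually_all_finite (Set.finite_Iio m)]
    intro k hk
    exact not_not.1 (Nat.find_min hex hk)
  have hne : ∀ᶠ t in 𝓝[≠] (0 : ℂ), (dirD e)^[m] u (q + t • l) ≠ 0 :=
    ((analyticAt_line (x := q) (v := l) (t := 0)
      (by simpa using analyticAt_iterate_dirD hau e m)).eventually_eq_zero_or_eventually_ne_zero
      ).resolve_left (Nat.find_spec hex)
  have hiso : ∀ᶠ t in 𝓝[≠] (0 : ℂ), f (q + t • l) ≠ 0 ∨ g (q + t • l) ≠ 0 := by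
    rw [eventually_nhdsWithin_iff]
    filter_upwards [htl.eventually (eventually_nhdsWithin_iff.1 hrep.isolated)] with t ht ht0
    exact ht (by simpa [hl] using ht0)
  filter_upwards [hne, hiso, eventually_nhdsWithin_of_eventually_nhds hlt.eventually_nhds,
    eventually_nhdsWithin_of_eventually_nhds (htl.eventually hrep.eventually)] with t h1 h2 h3 h4
  have hv : VanishesTo σ e (q + t • l) m u := by
    intro k hk
    -- a point of the line near `q + t • l` is `q + s • l` with `s` near `t`
    have hcont : Tendsto (fun z : ℂ × ℂ => t + cross (z - (q + t • l)) e / cross l e)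
        (𝓝 (q + t • l)) (𝓝 t) := by
      have : Continuous fun z : ℂ × ℂ => t + cross (z - (q + t • l)) e / cross l e := by
        unfold cross; fun_prop
      simpa [cross] using this.tendsto (q + t • l)
    filter_upwards [hcont.eventually h3] with z hz hσz
    have h5 := cross_smul_eq l e (z - (q + t • l))
    have h6 : cross l (z - (q + t • l)) = 0 := by
      simpa [hσ, hle] using hσz
    rw [h6, zero_smul, add_zero] at h5
    have h7 : z = q + (t + cross (z - (q + t • l)) e / cross l e) • l := by
      rw [add_smul, div_eq_inv_mul, mul_smul, ← h5, smul_smul, inv_mul_cancel₀ hle, one_smul]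
      abel
    rw [h7]
    exact hz k hk
  refine ⟨f, g, σ, m, h4, h2, fun h0 => ?_, hm1, ?_, ?_⟩
  · rw [h0] at hσe; simp at hσe
  · exact hv.isBigO_pow hσe (h4.analyticAt_member c) h1
  · exact ordGE_infl_of_vanishesTo h4 hσe hσl hle hm1 hv

/-- Each point of a linear fiber lies on a line of the fiber in the direction of a period. -/
lemma IsLinearFiber.exists_line (h : F.IsLinearFiber c) (hq : q ∈ F.zeroSet c) :
    ∃ l ∈ Λ, l ≠ 0 ∧ ∀ t : ℂ, q + t • l ∈ F.zeroSet c := by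
  obtain ⟨S, -, hS, hfib⟩ := h
  have hq' : proj Λ q ∈ F.fiber c := hq
  rw [hfib] at hq'
  obtain ⟨E, hE, hqE⟩ := hq'
  obtain ⟨L, r, hL, hspan, rfl⟩ := hS E hE
  obtain ⟨v, hv, hvq⟩ := hqE
  obtain ⟨l, hl, hl0⟩ : ∃ l ∈ (Λ : Set (ℂ × ℂ)) ∩ L, l ≠ 0 := by
    by_contra! hcon
    have : Submodule.span ℝ ((Λ : Set (ℂ × ℂ)) ∩ (L : Set (ℂ × ℂ))) = ⊥ :=
      Submodule.span_eq_bot.2 hcon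
    rw [this] at hspan
    have hbot : L = ⊥ := by
      rw [Submodule.eq_bot_iff]
      intro x hx
      have : x ∈ L.restrictScalars ℝ := hx
      rw [← hspan] at this
      simpa using this
    rw [hbot] at hL
    simp at hL
  refine ⟨l, hl.1, hl0, fun t => ?_⟩
  have hmem : proj Λ (r + (v + t • l)) ∈ F.fiber c := by
    rw [hfib]
    exact ⟨_, hE, v + t • l, L.add_mem hv (L.smul_mem t hl.2), rfl⟩
  have heq : proj Λ (q + t • l) = proj Λ (r + (v + t • l)) := by
    simp only [proj, Submodule.Quotient.eq] at hvq ⊢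
    have := Λ.neg_mem hvq
    convert this using 1
    abel
  change (proj Λ (q + t • l), c) ∈ F.graph
  rw [heq]
  exact hmem

lemma IsLinearFiber.zeroSet_nonempty (h : F.IsLinearFiber c) : (F.zeroSet c).Nonempty := by
  obtain ⟨S, ⟨E, hE⟩, hS, hfib⟩ := h
  obtain ⟨L, r, hL, hspan, rfl⟩ := hS E hE
  refine ⟨r, ?_⟩
  have : proj Λ (r + 0) ∈ F.fiber c := by
    rw [hfib]; exact ⟨_, hE, 0, L.zero_mem, rfl⟩
  rw [add_zero] at this
  exact this

/-- Off a countable set, a linear fiber is locally a multiple line. -/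
lemma IsLinearFiber.countable_not_isGood [DiscreteTopology Λ] (hF : F.Nonconst)
    (h : F.IsLinearFiber c) : {q | q ∈ F.zeroSet c ∧ ¬ F.IsGood c q}.Countable := by
  have : Countable Λ := TopologicalSpace.separableSpace_iff_countable.1 inferInstance
  have hsub : {q | q ∈ F.zeroSet c ∧ ¬ F.IsGood c q} ⊆
      ⋃ l : Λ, {q | (l : ℂ × ℂ) ≠ 0 ∧ (∀ t : ℂ, q + t • (l : ℂ × ℂ) ∈ F.zeroSet c) ∧
        ¬ F.IsGood c q} := by
    rintro q ⟨hq, hg⟩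
    obtain ⟨l, hl, hl0, ht⟩ := h.exists_line hq
    exact Set.mem_iUnion.2 ⟨⟨l, hl⟩, hl0, ht, hg⟩
  refine Set.Countable.mono hsub (Set.countable_iUnion fun l => ?_)
  by_cases hl : (l : ℂ × ℂ) = 0
  · simp [hl]
  obtain ⟨x, hx⟩ := hF.exists_notMem c
  obtain ⟨e, he⟩ := exists_cross_ne_zero hl
  have hA : {s : ℂ | x + s • e ∈ F.zeroSet c}.Countable :=
    countable_of_forall_eventually_notMem fun t =>
      eventually_notMem_line ⟨0, by simpa using hx⟩ t
  have hB : ∀ s : ℂ, (∀ t : ℂ, x + s • e + t • (l : ℂ × ℂ) ∈ F.zeroSet c) →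
      {t : ℂ | ¬ F.IsGood c (x + s • e + t • (l : ℂ × ℂ))}.Countable := by
    intro s hs
    refine countable_of_forall_eventually_notMem fun t => ?_
    have h1 := eventually_isGood_of_line (q := x + s • e + t • (l : ℂ × ℂ)) hF hl
      (fun t' => by rw [add_assoc, ← add_smul]; exact hs _)
    have h2 : Tendsto (fun r : ℂ => r - t) (𝓝[≠] t) (𝓝[≠] 0) := by
      refine tendsto_nhdsWithin_iff.2 ⟨?_, ?_⟩
      · exact ((Continuous.tendsto' (by fun_prop) t 0 (by simp)).mono_left nhdsWithin_le_nhds)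
      · filter_upwards [self_mem_nhdsWithin] with r hr
        exact sub_ne_zero.2 hr
    filter_upwards [h2.eventually h1] with r hr
    rw [add_assoc (x + s • e), ← add_smul, add_sub_cancel] at hr
    simpa using hr
  have hC := hA.biUnion (t := fun s _ => (fun t : ℂ => x + s • e + t • (l : ℂ × ℂ)) ''
    {t : ℂ | (∀ t : ℂ, x + s • e + t • (l : ℂ × ℂ) ∈ F.zeroSet c) ∧
      ¬ F.IsGood c (x + s • e + t • (l : ℂ × ℂ))}) (fun s _ => by
    by_cases hs : ∀ t : ℂ, x + s • e + t • (l : ℂ × ℂ) ∈ F.zeroSet c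
    · exact ((hB s hs).mono fun t ht => ht.2).image _
    · simp [hs])
  refine hC.mono ?_
  rintro q ⟨-, hq, hg⟩
  have h1 := cross_smul_eq (l : ℂ × ℂ) e (q - x)
  set s := cross (l : ℂ × ℂ) (q - x) / cross (l : ℂ × ℂ) e with hs
  set t := cross (q - x) e / cross (l : ℂ × ℂ) e with ht
  have h2 : q = x + s • e + t • (l : ℂ × ℂ) := by
    have : q - x = t • (l : ℂ × ℂ) + s • e := by
      rw [ht, hs, div_eq_inv_mul, div_eq_inv_mul, mul_smul, mul_smul, ← smul_add, ← h1, smul_smul,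
        inv_mul_cancel₀ he, one_smul]
    rw [add_assoc, add_comm (s • e), ← this]; abel
  have h3 : ∀ r : ℂ, x + s • e + r • (l : ℂ × ℂ) ∈ F.zeroSet c := by
    intro r
    have := hq (r - t)
    rw [h2, add_assoc (x + s • e), ← add_smul, add_sub_cancel] at this
    exact this
  refine Set.mem_biUnion (x := s) (by simpa using h3 0) ⟨t, ⟨h3, ?_⟩, h2.symm⟩
  rwa [← h2]

end MeromorphicMap

end ComplexTorus

namespace ComplexTorus

/-! ### The quotient of the inflection form by six members of the pencil -/

open Asymptotics

/-- The quotient of the inflection form by the product of the members `c ∈ C` of the pencil. -/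
noncomputable def quot (C : Finset P1) (f g : ℂ × ℂ → ℂ) (x : ℂ × ℂ) : ℂ :=
  infl (1, 0) (0, 1) f g x / ∏ c ∈ C, member c f g x

variable {f g f' g' : ℂ × ℂ → ℂ} {p q x d : ℂ × ℂ} {c c' : P1}

/-- Two reduced representations differ by a unit. -/
lemma IsLocalRep.exists_unit {Λ : Submodule ℤ (ℂ × ℂ)} {Γ : Set (Torus Λ × P1)}
    (h : IsLocalRep Γ x f g) (h' : IsLocalRep Γ x f' g') (hx : f x ≠ 0 ∨ g x ≠ 0) :
    ∃ w : ℂ × ℂ → ℂ, AnalyticAt ℂ w x ∧ w x ≠ 0 ∧ (f' =ᶠ[𝓝 x] fun y => w y * f y) ∧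
      g' =ᶠ[𝓝 x] fun y => w y * g y := by
  have hprop : ∀ᶠ y in 𝓝 x, f' y * g y = g' y * f y := by
    have hne : ∀ᶠ y in 𝓝 x, f y ≠ 0 ∨ g y ≠ 0 := by
      rcases hx with hx | hx
      · exact (h.analytic_left.continuousAt.eventually_ne hx).mono fun _ => Or.inl
      · exact (h.analytic_right.continuousAt.eventually_ne hx).mono fun _ => Or.inr
    filter_upwards [h.mem_graph_iff, h'.mem_graph_iff, hne] with y h1 h2 h3
    have h4 : (f y, g y) ≠ (0 : ℂ × ℂ) := by
      intro h0
      rcases h3 with h3 | h3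
      · exact h3 (congrArg Prod.fst h0)
      · exact h3 (congrArg Prod.snd h0)
    exact (h2 _ _ h4).1 ((h1 _ _ h4).2 (mul_comm _ _))
  have hiff : ∀ a b : ℂ, (a, b) ≠ (0 : ℂ × ℂ) → (f x * b = g x * a ↔ f' x * b = g' x * a) :=
    fun a b hab => (h.mem_graph_iff.self_of_nhds a b hab).symm.trans
      (h'.mem_graph_iff.self_of_nhds a b hab)
  rcases hx with hx | hx
  · have hx' : f' x ≠ 0 := fun h0 => hx (by
      simpa using (hiff 0 1 (by simp)).2 (by simp [h0]))
    refine ⟨fun y => f' y / f y, h'.analytic_left.div h.analytic_left hx, div_ne_zero hx' hx,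
      ?_, ?_⟩
    · filter_upwards [h.analytic_left.continuousAt.eventually_ne hx] with y hy
      field_simp
    · filter_upwards [h.analytic_left.continuousAt.eventually_ne hx, hprop] with y hy h1
      field_simp
      linear_combination -h1
  · have hx' : g' x ≠ 0 := fun h0 => hx (by
      simpa using ((hiff 1 0 (by simp)).2 (by simp [h0])).symm)
    refine ⟨fun y => g' y / g y, h'.analytic_right.div h.analytic_right hx, div_ne_zero hx' hx,
      ?_, ?_⟩
    · filter_upwards [h.analytic_right.continuousAt.eventually_ne hx, hprop] with y hy h1
      field_simp
      linear_combination h1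
    · filter_upwards [h.analytic_right.continuousAt.eventually_ne hx] with y hy
      field_simp

lemma dirD_comp_add_right (v l : ℂ × ℂ) (f : ℂ × ℂ → ℂ) :
    dirD v (fun y => f (y + l)) = fun y => dirD v f (y + l) := by
  funext y
  simp only [dirD]
  rw [fderiv_comp_add_right]

lemma infl_comp_add_right (d e l : ℂ × ℂ) (f g : ℂ × ℂ → ℂ) :
    infl d e (fun y => f (y + l)) (fun y => g (y + l)) = fun y => infl d e f g (y + l) := by
  have h : ∀ v, wr v (fun y => f (y + l)) (fun y => g (y + l)) = fun y => wr v f g (y + l) := by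
    intro v; funext y; simp only [wr, dirD_comp_add_right]
  funext y
  simp only [infl, curv, h, dirD_comp_add_right]

namespace MeromorphicMap

variable {Λ : Submodule ℤ (ℂ × ℂ)} (F : MeromorphicMap Λ) (C : Finset P1)

/-- The union of the fibers over `C`, in `ℂ²`. -/
def support : Set (ℂ × ℂ) := ⋃ c ∈ C, F.zeroSet c

open Classical in
/-- The function `quot` does not depend on the representation when `C` has six elements, and gives
a function on `ℂ²`; its values on `F.support C` are irrelevant. -/
noncomputable def quotFun (x : ℂ × ℂ) : ℂ :=
  quot C (F.exists_localRep x).choose (F.exists_localRep x).choose_spec.choose x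

variable {F C}

lemma notMem_support_iff : x ∉ F.support C ↔ ∀ c ∈ C, x ∉ F.zeroSet c := by
  simp [support]

variable (F C) in
lemma isClosed_support : IsClosed (F.support C) :=
  C.finite_toSet.isClosed_biUnion fun c _ => F.isClosed_zeroSet c

lemma eventually_notMem_support (h : x ∉ F.support C) : ∀ᶠ y in 𝓝 x, y ∉ F.support C :=
  (F.isClosed_support C).isOpen_compl.mem_nhds h

lemma Nonconst.dense_compl_support (hF : F.Nonconst) : Dense (F.support C)ᶜ := by
  rw [support, Set.compl_iUnion₂]
  exact dense_biInter_of_isOpen (S := (C : Set P1))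
    (fun c _ => (F.isClosed_zeroSet c).isOpen_compl) C.countable_toSet
    (fun c _ => hF.dense_compl c)

lemma eventually_notMem_support_line {t₁ : ℂ} (h : x + t₁ • d ∉ F.support C) (t : ℂ) :
    ∀ᶠ s in 𝓝[≠] t, x + s • d ∉ F.support C := by
  simp only [notMem_support_iff] at h ⊢
  rw [eventually_all_finset]
  exact fun c hc => eventually_notMem_line ⟨t₁, h c hc⟩ t

lemma ne_zero_of_notMem_zeroSet (h : IsLocalRep F.graph x f g) (hx : x ∉ F.zeroSet c) :
    f x ≠ 0 ∨ g x ≠ 0 := by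
  by_contra! h0
  exact hx ((mem_zeroSet_iff h c).2 (by simp [member, h0.1, h0.2]))

lemma ne_zero_of_notMem_support (hC : C.Nonempty) (h : IsLocalRep F.graph x f g)
    (hx : x ∉ F.support C) : f x ≠ 0 ∨ g x ≠ 0 := by
  obtain ⟨c, hc⟩ := hC
  exact ne_zero_of_notMem_zeroSet h (notMem_support_iff.1 hx c hc)

/-- The inflection form and a product of six members of the pencil have the same degree. -/
lemma quot_eq_of_isLocalRep (hC : C.card = 6) (h : IsLocalRep F.graph x f g)
    (h' : IsLocalRep F.graph x f' g') (hx : x ∉ F.support C) :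
    quot C f' g' x = quot C f g x := by
  have hne := ne_zero_of_notMem_support (Finset.card_pos.1 (by omega)) h hx
  obtain ⟨w, hw, hw0, hf, hg⟩ := h.exists_unit h' hne
  have h1 : ∀ c, member c f' g' x = w x * member c f g x := by
    intro c
    simp only [member]
    rw [hf.eq_of_nhds, hg.eq_of_nhds]; ring
  rw [quot, quot, infl_mul h.analytic_left h.analytic_right hw hf hg]
  simp only [h1]
  rw [Finset.prod_mul_distrib, Finset.prod_const, hC,
    mul_div_mul_left _ _ (pow_ne_zero _ hw0)]

lemma quotFun_eq (hC : C.card = 6) (h : IsLocalRep F.graph x f g) (hx : x ∉ F.support C) :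
    F.quotFun C x = quot C f g x :=
  quot_eq_of_isLocalRep hC h (F.exists_localRep x).choose_spec.choose_spec hx

lemma eventually_quotFun_eq (hC : C.card = 6) (h : IsLocalRep F.graph p f g) :
    ∀ᶠ x in 𝓝 p, x ∉ F.support C → F.quotFun C x = quot C f g x :=
  h.eventually.mono fun _ hx hxs => quotFun_eq hC hx hxs

lemma analyticAt_prod_member (h : IsLocalRep F.graph p f g) (C : Finset P1) :
    AnalyticAt ℂ (fun x => ∏ c ∈ C, member c f g x) p :=
  Finset.analyticAt_fun_prod C fun c _ => h.analyticAt_member c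

lemma continuousAt_quotFun (hC : C.card = 6) (hx : x ∉ F.support C) :
    ContinuousAt (F.quotFun C) x := by
  obtain ⟨f, g, h⟩ := F.exists_localRep x
  have h1 : F.quotFun C =ᶠ[𝓝 x] quot C f g := by
    filter_upwards [eventually_quotFun_eq hC h, eventually_notMem_support hx] with y h2 h3
      using h2 h3
  refine ContinuousAt.congr ?_ h1.symm
  refine (analyticAt_infl h.analytic_left h.analytic_right _ _).continuousAt.div
    (analyticAt_prod_member h C).continuousAt (Finset.prod_ne_zero_iff.2 fun c hc h0 => ?_)
  exact notMem_support_iff.1 hx c hc ((mem_zeroSet_iff h c).2 h0)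

lemma continuousAt_quotFun_line (hC : C.card = 6) {t : ℂ} (hx : x + t • d ∉ F.support C) :
    ContinuousAt (fun s : ℂ => F.quotFun C (x + s • d)) t :=
  ContinuousAt.comp (f := fun s : ℂ => x + s • d) (continuousAt_quotFun hC hx)
    (tendsto_line x d t)

lemma meromorphicAt_quotFun_line (hC : C.card = 6) {t₁ : ℂ} (h : x + t₁ • d ∉ F.support C)
    (t : ℂ) : MeromorphicAt (fun s : ℂ => F.quotFun C (x + s • d)) t := by
  obtain ⟨f, g, hrep⟩ := F.exists_localRep (x + t • d)
  have h1 : MeromorphicAt (fun s : ℂ => quot C f g (x + s • d)) t :=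
    (analyticAt_line (analyticAt_infl hrep.analytic_left hrep.analytic_right _ _)).meromorphicAt.div
      (analyticAt_line (analyticAt_prod_member hrep C)).meromorphicAt
  refine h1.congr ?_
  filter_upwards [eventually_notMem_support_line h t, eventually_nhdsWithin_of_eventually_nhds
    ((tendsto_line x d t).eventually (eventually_quotFun_eq hC hrep))] with s h2 h3
  exact (h3 h2).symm

lemma quotFun_add_lattice (hC : C.card = 6) {l : ℂ × ℂ} (hl : l ∈ Λ) (hx : x ∉ F.support C) :
    F.quotFun C (x + l) = F.quotFun C x := by
  obtain ⟨f, g, h⟩ := F.exists_localRep (x + l)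
  have hx' : x + l ∉ F.support C := by
    rw [notMem_support_iff] at hx ⊢
    exact fun c hc => by rw [add_mem_zeroSet_iff hl]; exact hx c hc
  have hadd : Tendsto (fun y : ℂ × ℂ => y + l) (𝓝 x) (𝓝 (x + l)) :=
    Continuous.tendsto (by fun_prop) x
  have hproj : ∀ y, proj Λ (y + l) = proj Λ y := fun y => by
    rw [proj, proj, Submodule.Quotient.eq]; simpa using hl
  have h' : IsLocalRep F.graph x (fun y => f (y + l)) (fun y => g (y + l)) := by
    refine ⟨h.analytic_left.comp_of_eq (analyticAt_id.add analyticAt_const) rfl,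
      h.analytic_right.comp_of_eq (analyticAt_id.add analyticAt_const) rfl, ?_, ?_⟩
    · have := eventually_nhdsWithin_iff.1 h.isolated
      rw [eventually_nhdsWithin_iff]
      filter_upwards [hadd.eventually this] with y hy hyx
      exact hy (by simpa using hyx)
    · filter_upwards [hadd.eventually h.mem_graph_iff] with y hy a b hab
      rw [← hy a b hab, hproj]
  rw [quotFun_eq hC h hx', quotFun_eq hC h' hx, quot, quot, infl_comp_add_right]
  rfl

/-- Near a point where the fiber is a line of multiplicity `m`, the quotient vanishes to order
`2 * m - 2` along the line. -/
lemma exists_isBigO_quotFun (hC : C.card = 6) (hc : c ∈ C) (hq : q ∈ F.zeroSet c)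
    {σ : ℂ × ℂ →L[ℂ] ℂ} {m : ℕ} (hrep : IsLocalRep F.graph q f g) (hfg : f q ≠ 0 ∨ g q ≠ 0)
    (hm : 1 ≤ m) (hσ : (fun z => σ (z - q) ^ m) =O[𝓝 q] member c f g)
    (hinfl : OrdGE σ q (3 * m - 2) (infl (1, 0) (0, 1) f g)) :
    F.quotFun C =O[𝓝[(F.support C)ᶜ] q] fun z => σ (z - q) ^ (2 * m - 2) := by
  classical
  have h1 : infl (1, 0) (0, 1) f g =O[𝓝 q] fun z => member c f g z * σ (z - q) ^ (2 * m - 2) := by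
    refine IsBigO.trans hinfl ?_
    have := hσ.mul (isBigO_refl (fun z => σ (z - q) ^ (2 * m - 2)) (𝓝 q))
    refine this.congr_left fun z => ?_
    rw [← pow_add]; congr 1; omega
  have h2 : (fun z => (∏ c' ∈ C.erase c, member c' f g z)⁻¹) =O[𝓝 q] fun _ => (1 : ℂ) := by
    have hne : ∏ c' ∈ C.erase c, member c' f g q ≠ 0 := by
      refine Finset.prod_ne_zero_iff.2 fun c' hc' h0 => ?_
      have := eq_zero_of_member_eq_zero (Finset.ne_of_mem_erase hc') h0
        ((mem_zeroSet_iff hrep c).1 hq)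
      rcases hfg with h | h
      · exact h this.1
      · exact h this.2
    exact ((analyticAt_prod_member hrep _).inv hne).continuousAt.isBigO_one ℂ
  have h3 : (fun z => infl (1, 0) (0, 1) f g z * (∏ c' ∈ C.erase c, member c' f g z)⁻¹ *
      (member c f g z)⁻¹) =O[𝓝[(F.support C)ᶜ] q]
      fun z => member c f g z * σ (z - q) ^ (2 * m - 2) * 1 * (member c f g z)⁻¹ :=
    ((h1.mul h2).mono nhdsWithin_le_nhds).mul (isBigO_refl _ _)
  refine h3.congr' ?_ ?_
  · filter_upwards [self_mem_nhdsWithin, eventually_nhdsWithin_of_eventually_nhds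
      (eventually_quotFun_eq hC hrep)] with z hz hz'
    rw [hz' hz, quot, ← Finset.prod_erase_mul C _ hc, div_eq_mul_inv, mul_inv, mul_assoc]
  · filter_upwards [self_mem_nhdsWithin, eventually_nhdsWithin_of_eventually_nhds
      (eventually_mem_zeroSet_iff hrep c)] with z hz hz'
    have : member c f g z ≠ 0 := fun h0 => notMem_support_iff.1 hz c hc (hz'.2 h0)
    field_simp

/-! ### The quotient is bounded, hence constant -/

lemma exists_bound_of_notMem (hC : C.card = 6) (hq : q ∉ F.support C) :
    ∃ M : ℝ, ∀ᶠ x in 𝓝 q, x ∉ F.support C → ‖F.quotFun C x‖ ≤ M := by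
  refine ⟨‖F.quotFun C q‖ + 1, ?_⟩
  have := (continuousAt_quotFun hC hq).norm.eventually_lt continuousAt_const
    (lt_add_one ‖F.quotFun C q‖)
  exact this.mono fun x hx _ => hx.le

lemma exists_bound_of_isGood (hC : C.card = 6) (hc : c ∈ C) (hq : q ∈ F.zeroSet c)
    (hg : F.IsGood c q) : ∃ M : ℝ, ∀ᶠ x in 𝓝 q, x ∉ F.support C → ‖F.quotFun C x‖ ≤ M := by
  obtain ⟨f, g, σ, m, hrep, hfg, -, hm, hσ, hinfl⟩ := hg
  have h1 := exists_isBigO_quotFun hC hc hq hrep hfg hm hσ hinfl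
  have h2 : (fun z => σ (z - q) ^ (2 * m - 2)) =O[𝓝[(F.support C)ᶜ] q] fun _ => (1 : ℂ) := by
    have : Continuous fun z : ℂ × ℂ => σ (z - q) ^ (2 * m - 2) := by fun_prop
    exact (this.continuousAt.isBigO_one ℂ).mono nhdsWithin_le_nhds
  obtain ⟨M, hM⟩ := (h1.trans h2).bound
  refine ⟨M, ?_⟩
  rw [eventually_nhdsWithin_iff] at hM
  exact hM.mono fun x hx hxs => by simpa using hx hxs

/-- The quotient is locally bounded, also at the points of indeterminacy: by the maximum principle
on discs that avoid the countably many points where the fibers are not multiple lines. -/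
lemma exists_bound_nhds [DiscreteTopology Λ] (hF : F.Nonconst) (hC : C.card = 6)
    (hlin : ∀ c ∈ C, F.IsLinearFiber c) (p : ℂ × ℂ) :
    ∃ M : ℝ, ∀ᶠ x in 𝓝 p, x ∉ F.support C → ‖F.quotFun C x‖ ≤ M := by
  by_cases hp : p ∉ F.support C
  · exact exists_bound_of_notMem hC hp
  rw [not_not] at hp
  set B : Set (ℂ × ℂ) := ⋃ c ∈ C, {q | q ∈ F.zeroSet c ∧ ¬ F.IsGood c q} with hB
  have hBc : B.Countable := C.countable_toSet.biUnion fun c hc =>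
    (hlin c hc).countable_not_isGood hF
  have hbound : ∀ q, q ∉ B → ∃ M : ℝ, ∀ᶠ x in 𝓝 q, x ∉ F.support C → ‖F.quotFun C x‖ ≤ M := by
    intro q hqB
    by_cases hq : q ∈ F.support C
    · obtain ⟨c, hc, hqc⟩ := Set.mem_iUnion₂.1 hq
      refine exists_bound_of_isGood hC hc hqc ?_
      by_contra hg
      exact hqB (Set.mem_iUnion₂.2 ⟨c, hc, hqc, hg⟩)
    · exact exists_bound_of_notMem hC hq
  obtain ⟨y, hy⟩ := (hF.dense_compl_support (C := C)).nonempty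
  set e := y - p with he
  have he0 : e ≠ 0 := fun h => hy (by rwa [sub_eq_zero.1 h])
  have hye : p + (1 : ℂ) • e ∉ F.support C := by simpa [he] using hy
  obtain ⟨d, hd⟩ := exists_cross_ne_zero he0
  obtain ⟨R, hR, hRb⟩ := Metric.nhds_basis_closedBall.eventually_iff.1
    (eventually_nhdsWithin_iff.1 (eventually_notMem_support_line hye 0))
  have hsph : ∀ t ∈ Metric.sphere (0 : ℂ) R, p + t • e ∉ F.support C := fun t ht =>
    hRb (Metric.sphere_subset_closedBall ht) (by rintro rfl; simp [hR.ne] at ht)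
  obtain ⟨M, hM⟩ := (isCompact_sphere (0 : ℂ) R).exists_bound_of_continuousOn
    (f := fun t : ℂ => F.quotFun C (p + t • e))
    (fun t ht => (continuousAt_quotFun_line hC (hsph t ht)).continuousWithinAt)
  have htube := eventually_forall_of_isCompact
    (P := fun x => x ∉ F.support C ∧ ‖F.quotFun C x‖ ≤ M + 1)
    (isCompact_sphere (0 : ℂ) R) (p := p) (e := e) fun t ht => by
      filter_upwards [eventually_notMem_support (hsph t ht),
        (continuousAt_quotFun hC (hsph t ht)).norm.eventually_lt continuousAt_const
          ((hM t ht).trans_lt (lt_add_one M))] with x h1 h2 using ⟨h1, h2.le⟩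
  refine ⟨M + 1, ?_⟩
  filter_upwards [htube.eventually_nhds] with z hz hzs
  by_contra hlt
  rw [not_le] at hlt
  -- some disc close to the one through `z` avoids the countable set `B`
  have hnear : ∀ᶠ z' in 𝓝 z, (∀ t ∈ Metric.sphere (0 : ℂ) R, z' + t • e ∉ F.support C ∧
      ‖F.quotFun C (z' + t • e)‖ ≤ M + 1) ∧ z' ∉ F.support C ∧ M + 1 < ‖F.quotFun C z'‖ :=
    hz.and ((eventually_notMem_support hzs).and
      (continuousAt_const.eventually_lt (continuousAt_quotFun hC hzs).norm hlt))
  have hzd : Tendsto (fun s : ℂ => z + s • d) (𝓝 0) (𝓝 z) := by simpa using tendsto_line z d 0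
  obtain ⟨s, hsB, hs⟩ := ((hBc.image fun b => cross e (b - z) / cross e d).dense_compl
    ℂ).inter_nhds_nonempty (hzd.eventually hnear)
  obtain ⟨h1, h2, h3⟩ := hs
  set z' := z + s • d with hz'
  have hdisc : ∀ t : ℂ, z' + t • e ∉ B := fun t ht => hsB ⟨_, ht, by
    rw [div_eq_iff hd]
    simp [hz', cross]
    ring⟩
  have h20 : z' + (0 : ℂ) • e ∉ F.support C := by simpa using h2
  have hmax := norm_le_of_sphere (h := fun t : ℂ => F.quotFun C (z' + t • e)) (M := M + 1) hR
    (fun t _ => meromorphicAt_quotFun_line hC h20 t)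
    (fun t _ => by
      obtain ⟨M', hM'⟩ := hbound _ (hdisc t)
      refine ⟨M', ?_⟩
      filter_upwards [eventually_notMem_support_line h20 t,
        eventually_nhdsWithin_of_eventually_nhds ((tendsto_line z' e t).eventually hM')]
        with r h4 h5 using h5 h4)
    (fun t ht => ⟨continuousAt_quotFun_line hC (h1 t ht).1, (h1 t ht).2⟩)
    (continuousAt_quotFun_line hC h20)
  simp only [zero_smul, add_zero] at hmax
  exact absurd hmax (not_le.2 h3)

lemma exists_isCompact_lattice (Λ : Submodule ℤ (ℂ × ℂ)) [DiscreteTopology Λ] [IsZLattice ℝ Λ] :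
    ∃ K : Set (ℂ × ℂ), IsCompact K ∧ ∀ x, ∃ l ∈ Λ, x + l ∈ K := by
  have := ZLattice.module_free ℝ Λ
  let b := Module.Free.chooseBasis ℤ Λ
  refine ⟨_, (b.ofZLatticeBasis ℝ).parallelepiped.isCompact, fun x => ?_⟩
  let x' : Λ := b.repr.symm (Finsupp.equivFunOnFinite.symm
    fun i ↦ ⌊(b.ofZLatticeBasis ℝ).repr x i⌋)
  refine ⟨-x', (-x').2, ?_⟩
  simp [parallelepiped_basis_eq, x', Int.floor_le, Int.lt_floor_add_one, le_of_lt, add_comm (1 : ℝ)]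

variable [DiscreteTopology Λ] [IsZLattice ℝ Λ]

lemma exists_bound (hF : F.Nonconst) (hC : C.card = 6) (hlin : ∀ c ∈ C, F.IsLinearFiber c) :
    ∃ M : ℝ, ∀ x, x ∉ F.support C → ‖F.quotFun C x‖ ≤ M := by
  obtain ⟨K, hK, hcover⟩ := exists_isCompact_lattice Λ
  obtain ⟨M, hM⟩ : ∃ M : ℝ, ∀ x ∈ K, x ∉ F.support C → ‖F.quotFun C x‖ ≤ M := by
    refine hK.induction_on (p := fun S => ∃ M : ℝ, ∀ x ∈ S, x ∉ F.support C →
      ‖F.quotFun C x‖ ≤ M) ⟨0, by simp⟩ ?_ ?_ ?_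
    · rintro s t hst ⟨M, hM⟩
      exact ⟨M, fun x hx => hM x (hst hx)⟩
    · rintro s t ⟨M, hM⟩ ⟨M', hM'⟩
      refine ⟨max M M', fun x hx hxs => ?_⟩
      rcases hx with hx | hx
      · exact (hM x hx hxs).trans (le_max_left _ _)
      · exact (hM' x hx hxs).trans (le_max_right _ _)
    · intro x _
      obtain ⟨M, hM⟩ := exists_bound_nhds hF hC hlin x
      exact ⟨_, mem_nhdsWithin_of_mem_nhds hM, M, fun y hy => hy⟩
  refine ⟨M, fun x hx => ?_⟩
  obtain ⟨l, hl, hxl⟩ := hcover x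
  rw [← quotFun_add_lattice hC hl hx]
  refine hM _ hxl ?_
  rw [notMem_support_iff] at hx ⊢
  exact fun c hc => by rw [add_mem_zeroSet_iff hl]; exact hx c hc

lemma exists_quotFun_eq_const (hF : F.Nonconst) (hC : C.card = 6)
    (hlin : ∀ c ∈ C, F.IsLinearFiber c) :
    ∃ κ : ℂ, ∀ x, x ∉ F.support C → F.quotFun C x = κ := by
  obtain ⟨M, hM⟩ := exists_bound hF hC hlin
  obtain ⟨z, hz⟩ := (hF.dense_compl_support (C := C)).nonempty
  refine ⟨F.quotFun C z, fun x hx => ?_⟩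
  have h0 : z + (0 : ℂ) • (x - z) ∉ F.support C := by simpa using hz
  have h1 : z + (1 : ℂ) • (x - z) ∉ F.support C := by simpa using hx
  have := eq_of_bounded (h := fun t : ℂ => F.quotFun C (z + t • (x - z))) (M := M)
    (fun t _ => meromorphicAt_quotFun_line hC h0 t)
    (fun t => (eventually_notMem_support_line h0 t).mono fun s hs => hM _ hs)
    (continuousAt_quotFun_line hC h1) (continuousAt_quotFun_line hC h0)
  simpa using this

end MeromorphicMap

end ComplexTorus

namespace ComplexTorus

namespace MeromorphicMap

variable {Λ : Submodule ℤ (ℂ × ℂ)} {F : MeromorphicMap Λ}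
variable {f g : ℂ × ℂ → ℂ} {p q x d v : ℂ × ℂ} {c c' : P1}

/-! ### Maps without inflection -/

/-- If `f / g` is constant near `q` on a line, then the line lies in a fiber. -/
lemma line_subset_zeroSet_of_wr_eq_zero (h : IsLocalRep F.graph q f g) (hfg : f q ≠ 0 ∨ g q ≠ 0)
    (hq : q ∈ F.zeroSet c) (hw : ∀ᶠ t : ℂ in 𝓝 0, wr v f g (q + t • v) = 0) (t : ℂ) :
    q + t • v ∈ F.zeroSet c := by
  have hlim : Tendsto (fun s : ℂ => q + s • v) (𝓝 0) (𝓝 q) := by simpa using tendsto_line q v 0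
  have han : ∀ {w : ℂ × ℂ → ℂ}, AnalyticAt ℂ w q →
      AnalyticAt ℂ (fun s : ℂ => w (q + s • v)) 0 := fun hw => analyticAt_line (by simpa using hw)
  have hu0 : member c f g (q + (0 : ℂ) • v) = 0 := by simpa using (mem_zeroSet_iff h c).1 hq
  have hder : ∀ᶠ s in 𝓝 (0 : ℂ), deriv (fun s : ℂ => member c f g (q + s • v)) s =
      dirD v f (q + s • v) * c.rep.2 - dirD v g (q + s • v) * c.rep.1 := by
    filter_upwards [hlim.eventually h.analytic_left.eventually_analyticAt,
      hlim.eventually h.analytic_right.eventually_analyticAt] with s h1 h2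
    exact (((hasDerivAt_line h1).mul_const _).sub ((hasDerivAt_line h2).mul_const _)).deriv
  have hzero : ∀ᶠ s in 𝓝 (0 : ℂ), member c f g (q + s • v) = 0 := by
    rcases hfg with hf | hg
    · refine eventually_eq_zero_of_deriv (han (h.analyticAt_member c)) (han h.analytic_left)
        (han (analyticAt_dirD h.analytic_left v)) (by simpa using hf) hu0 ?_
      filter_upwards [hder, hw] with s h1 h2
      rw [h1]
      simp only [member, wr] at h2 ⊢
      linear_combination (c.rep.1) * h2
    · refine eventually_eq_zero_of_deriv (han (h.analyticAt_member c)) (han h.analytic_right)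
        (han (analyticAt_dirD h.analytic_right v)) (by simpa using hg) hu0 ?_
      filter_upwards [hder, hw] with s h1 h2
      rw [h1]
      simp only [member, wr] at h2 ⊢
      linear_combination (c.rep.2) * h2
  have hmem : ∀ᶠ s in 𝓝 (0 : ℂ), q + s • v ∈ F.zeroSet c := by
    filter_upwards [hzero, hlim.eventually (eventually_mem_zeroSet_iff h c)] with s h1 h2
      using h2.2 h1
  exact line_subset_zeroSet (eventually_nhdsWithin_of_eventually_nhds hmem).frequently t

/-- If the inflection form vanishes, the fiber through a regular point contains its tangent. -/
lemma tangent_subset_zeroSet (h : IsLocalRep F.graph q f g) (hfg : f q ≠ 0 ∨ g q ≠ 0)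
    (hq : q ∈ F.zeroSet c) (hK : ∀ᶠ x in 𝓝 q, infl (1, 0) (0, 1) f g x = 0)
    (hreg : wr (1, 0) f g q ≠ 0 ∨ wr (0, 1) f g q ≠ 0) (t : ℂ) :
    q + t • ((wr (0, 1) f g q, -wr (1, 0) f g q) : ℂ × ℂ) ∈ F.zeroSet c := by
  set A := wr (1, 0) f g with hA
  set B := wr (0, 1) f g with hB
  set v : ℂ × ℂ := (B q, -A q) with hv
  have aA : AnalyticAt ℂ A q := analyticAt_wr h.analytic_left h.analytic_right _
  have aB : AnalyticAt ℂ B q := analyticAt_wr h.analytic_left h.analytic_right _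
  have hlim : Tendsto (fun s : ℂ => q + s • v) (𝓝 0) (𝓝 q) := by simpa using tendsto_line q v 0
  have han : ∀ {w : ℂ × ℂ → ℂ}, AnalyticAt ℂ w q →
      AnalyticAt ℂ (fun s : ℂ => w (q + s • v)) 0 := fun hw => analyticAt_line (by simpa using hw)
  set Y : ℂ × ℂ → ℂ := fun x => A x * B q - B x * A q with hY
  have aY : AnalyticAt ℂ Y q := (aA.mul analyticAt_const).sub (aB.mul analyticAt_const)
  have hY0 : Y (q + (0 : ℂ) • v) = 0 := by simp [hY]; ring
  have hder : ∀ᶠ s in 𝓝 (0 : ℂ), deriv (fun s : ℂ => Y (q + s • v)) s =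
      (B q * dirD (1, 0) A (q + s • v) - A q * dirD (0, 1) A (q + s • v)) * B q -
      (B q * dirD (1, 0) B (q + s • v) - A q * dirD (0, 1) B (q + s • v)) * A q := by
    filter_upwards [hlim.eventually aA.eventually_analyticAt,
      hlim.eventually aB.eventually_analyticAt] with s h1 h2
    have h3 := (((hasDerivAt_line h1).mul_const (B q)).sub
      ((hasDerivAt_line h2).mul_const (A q))).deriv
    rw [dirD_eq_coord v A, dirD_eq_coord v B] at h3
    refine Eq.trans h3 ?_
    simp only [hv]; ring
  have hYzero : ∀ᶠ s in 𝓝 (0 : ℂ), Y (q + s • v) = 0 := by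
    -- `B ^ 2 * Y'`, or `A ^ 2 * Y'`, is a multiple of `Y` modulo the inflection form
    rcases hreg with hreg | hreg
    · refine eventually_eq_zero_of_deriv (b := fun s => A (q + s • v) ^ 2)
        (k := fun s => dirD (1, 0) A (q + s • v) * (Y (q + s • v) + 2 * (B (q + s • v) * A q)) -
          (dirD (0, 1) A (q + s • v) + dirD (1, 0) B (q + s • v)) * (A (q + s • v) * A q))
        (han aY) ((han aA).pow 2)
        (((han (analyticAt_dirD aA _)).mul ((han aY).add (analyticAt_const.mul
          ((han aB).mul analyticAt_const)))).sub (((han (analyticAt_dirD aA _)).add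
          (han (analyticAt_dirD aB _))).mul ((han aA).mul analyticAt_const)))
        (by simpa using hreg) hY0 ?_
      filter_upwards [hder, hlim.eventually hK] with s h1 h2
      rw [h1]
      simp only [infl, curv, ← hA, ← hB] at h2
      simp only [hY]
      linear_combination (A q) ^ 2 * h2
    · refine eventually_eq_zero_of_deriv (b := fun s => B (q + s • v) ^ 2)
        (k := fun s => (dirD (0, 1) A (q + s • v) + dirD (1, 0) B (q + s • v)) *
          (B (q + s • v) * B q) +
          dirD (0, 1) B (q + s • v) * (Y (q + s • v) - 2 * (A (q + s • v) * B q)))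
        (han aY) ((han aB).pow 2)
        ((((han (analyticAt_dirD aA _)).add (han (analyticAt_dirD aB _))).mul
          ((han aB).mul analyticAt_const)).add ((han (analyticAt_dirD aB _)).mul ((han aY).sub
          (analyticAt_const.mul ((han aA).mul analyticAt_const)))))
        (by simpa using hreg) hY0 ?_
      filter_upwards [hder, hlim.eventually hK] with s h1 h2
      rw [h1]
      simp only [infl, curv, ← hA, ← hB] at h2
      simp only [hY]
      linear_combination (B q) ^ 2 * h2
  refine line_subset_zeroSet_of_wr_eq_zero h hfg hq (hYzero.mono fun s hs => ?_) t
  have : wr v f g (q + s • v) = v.1 * A (q + s • v) + v.2 * B (q + s • v) := by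
    simp only [hA, hB, wr]; rw [dirD_eq_coord v f, dirD_eq_coord v g]; ring
  rw [this]
  simp only [hY] at hs
  simp only [hv]
  linear_combination hs

variable (F) in
/-- The fiber over `c` contains a complex line through `q`. -/
def HasLine (c : P1) (q : ℂ × ℂ) : Prop := ∃ d : ℂ × ℂ, ‖d‖ = 1 ∧ ∀ t : ℂ, q + t • d ∈ F.zeroSet c

lemma hasLine_of_ne_zero (hv : v ≠ 0) (h : ∀ t : ℂ, q + t • v ∈ F.zeroSet c) : F.HasLine c q := by
  refine ⟨((‖v‖⁻¹ : ℝ) : ℂ) • v, ?_, fun t => ?_⟩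
  · rw [norm_smul, Complex.norm_real, norm_inv, norm_norm, inv_mul_cancel₀ (norm_ne_zero_iff.2 hv)]
  · rw [smul_smul]; exact h _

lemma mem_zeroSet_mk_iff (h : IsLocalRep F.graph x f g) {w : ℂ × ℂ} (hw : w ≠ 0) :
    x ∈ F.zeroSet (Projectivization.mk ℂ w hw) ↔ f x * w.2 = g x * w.1 :=
  h.mem_graph_iff.self_of_nhds w.1 w.2 hw

/-- A limit of lines contained in fibers is a line contained in the limit fiber. -/
lemma HasLine.of_tendsto {y w : ℕ → ℂ × ℂ} {w₀ : ℂ × ℂ} (hy : Tendsto y atTop (𝓝 q))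
    (hw : Tendsto w atTop (𝓝 w₀)) (hw₀ : w₀ ≠ 0) (hwn : ∀ n, w n ≠ 0)
    (h : ∀ n, F.HasLine (Projectivization.mk ℂ (w n) (hwn n)) (y n)) :
    F.HasLine (Projectivization.mk ℂ w₀ hw₀) q := by
  choose d hd hline using h
  obtain ⟨d₀, hd₀, φ, hφ, hlim⟩ := (isCompact_sphere (0 : ℂ × ℂ) 1).tendsto_subseq
    (x := d) (fun n => by simpa using hd n)
  refine ⟨d₀, by simpa using hd₀, fun t => ?_⟩
  obtain ⟨f, g, hrep⟩ := F.exists_localRep (q + t • d₀)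
  have h1 : Tendsto (fun n => y (φ n) + t • d (φ n)) atTop (𝓝 (q + t • d₀)) :=
    (hy.comp hφ.tendsto_atTop).add (hlim.const_smul t)
  have h2 := hw.comp hφ.tendsto_atTop
  rw [mem_zeroSet_mk_iff hrep]
  have h3 := (hrep.analytic_left.continuousAt.tendsto.comp h1).mul
    ((continuous_snd.tendsto w₀).comp h2)
  have h4 := (hrep.analytic_right.continuousAt.tendsto.comp h1).mul
    ((continuous_fst.tendsto w₀).comp h2)
  refine tendsto_nhds_unique_of_eventuallyEq h3 h4 ?_
  filter_upwards [h1.eventually hrep.eventually] with n hn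
  exact (mem_zeroSet_mk_iff hn (hwn (φ n))).1 (hline (φ n) t)

/-- A map whose inflection form vanishes has lines through all the points of its fibers. -/
lemma hasLine_of_infl_eq_zero (hF : F.Nonconst)
    (hK : ∀ p f g, IsLocalRep F.graph p f g → infl (1, 0) (0, 1) f g p = 0)
    (hq : q ∈ F.zeroSet c) : F.HasLine c q := by
  have hdet : ∀ {c q f g}, q ∈ F.zeroSet c → IsLocalRep F.graph q f g → (f q ≠ 0 ∨ g q ≠ 0) →
      F.HasLine c q := by
    intro c q f g hq hrep hfg
    have hne : ∀ {x}, (f x ≠ 0 ∨ g x ≠ 0) → (f x, g x) ≠ (0 : ℂ × ℂ) := fun hx h0 =>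
      hx.elim (fun h => h (congrArg Prod.fst h0)) (fun h => h (congrArg Prod.snd h0))
    have hfg' : ∀ᶠ x in 𝓝 q, f x ≠ 0 ∨ g x ≠ 0 := by
      rcases hfg with hx | hx
      · exact (hrep.analytic_left.continuousAt.eventually_ne hx).mono fun _ => Or.inl
      · exact (hrep.analytic_right.continuousAt.eventually_ne hx).mono fun _ => Or.inr
    -- regular points are dense, since the map is not constant
    have hreg : ∃ᶠ x in 𝓝 q, wr (1, 0) f g x ≠ 0 ∨ wr (0, 1) f g x ≠ 0 := by
      intro hcon
      obtain ⟨y, hy⟩ := hF.exists_notMem c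
      apply hy
      have hlim : Tendsto (fun s : ℂ => q + s • (y - q)) (𝓝 0) (𝓝 q) := by
        simpa using tendsto_line q (y - q) 0
      have := line_subset_zeroSet_of_wr_eq_zero (v := y - q) hrep hfg hq
        ((hlim.eventually hcon).mono fun s hs => by
          rw [not_or, not_not, not_not] at hs
          simp only [wr] at hs ⊢
          rw [dirD_eq_coord (y - q) f, dirD_eq_coord (y - q) g]
          linear_combination (y - q).1 * hs.1 + (y - q).2 * hs.2) 1
      simpa using this
    obtain ⟨y, hy, hyn⟩ := exists_seq_forall_of_frequently
      (hreg.and_eventually (hfg'.and hrep.eventually))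
    have hwn : ∀ n, (f (y n), g (y n)) ≠ (0 : ℂ × ℂ) := fun n => hne (hyn n).2.1
    have hc : Projectivization.mk ℂ (f q, g q) (hne hfg) = c := by
      rw [← c.mk_rep]
      exact mk_eq_of_cross_eq_zero _ _ ((mem_zeroSet_iff hrep c).1 hq)
    rw [← hc]
    refine HasLine.of_tendsto (w := fun n => (f (y n), g (y n))) hy
      ((hrep.analytic_left.continuousAt.tendsto.comp hy).prodMk_nhds
        (hrep.analytic_right.continuousAt.tendsto.comp hy)) _ hwn fun n => ?_
    obtain ⟨hr, hfgn, hrepn⟩ := hyn n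
    refine hasLine_of_ne_zero (fun h0 => ?_) (tangent_subset_zeroSet hrepn hfgn
      ((mem_zeroSet_mk_iff hrepn _).2 (mul_comm _ _))
      (hrepn.eventually.mono fun x hx => hK x f g hx) hr)
    have h1 := congrArg Prod.fst h0
    have h2 := congrArg Prod.snd h0
    simp only [Prod.fst_zero, Prod.snd_zero, neg_eq_zero] at h1 h2
    exact hr.elim (fun h => h h2) (fun h => h h1)
  obtain ⟨f, g, hrep⟩ := F.exists_localRep q
  -- a point of indeterminacy is a limit of other points of the fiber
  have hfreq : ∃ᶠ x in 𝓝 q, F.HasLine c x := by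
    intro hcon
    have hN : {x | ¬ F.HasLine c x ∧ IsLocalRep F.graph x f g ∧
        (x ≠ q → f x ≠ 0 ∨ g x ≠ 0)} ∈ 𝓝 q :=
      hcon.and (hrep.eventually.and (eventually_nhdsWithin_iff.1 hrep.isolated))
    refine not_countable_zeros (hrep.analyticAt_member c) ((mem_zeroSet_iff hrep c).1 hq) hN
      ((Set.countable_singleton q).mono ?_)
    rintro x ⟨⟨h1, h2, h3⟩, h4⟩
    by_contra hxq
    exact h1 (hdet ((mem_zeroSet_iff h2 c).2 h4) h2 (h3 hxq))
  obtain ⟨y, hy, hyn⟩ := exists_seq_forall_of_frequently hfreq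
  have := HasLine.of_tendsto (F := F) (w := fun _ => c.rep) hy tendsto_const_nhds c.rep_nonzero
    (fun _ => c.rep_nonzero) (fun n => by rw [c.mk_rep]; exact hyn n)
  rwa [c.mk_rep] at this

/-! ### Lines in a fiber are subtori -/

/-- The periods project to a discrete subgroup along a line contained in a fiber. -/
lemma eventually_ne_cross_period (hF : F.Nonconst) (hd : d ≠ 0)
    (h : ∀ t : ℂ, x + t • d ∈ F.zeroSet c) : ∀ᶠ z in 𝓝[≠] (0 : ℂ), ∀ l ∈ Λ, cross d l ≠ z := by
  obtain ⟨e, he⟩ := exists_cross_ne_zero hd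
  obtain ⟨y, hy⟩ := hF.exists_notMem c
  have h1 := cross_smul_eq d e (y - x)
  set t₀ := cross (y - x) e / cross d e with ht₀
  set s₀ := cross d (y - x) / cross d e with hs₀
  have h2 : y = x + t₀ • d + s₀ • e := by
    have : y - x = t₀ • d + s₀ • e := by
      rw [ht₀, hs₀, div_eq_inv_mul, div_eq_inv_mul, mul_smul, mul_smul, ← smul_add, ← h1,
        smul_smul, inv_mul_cancel₀ he, one_smul]
    rw [add_assoc, ← this]; abel
  have h3 := eventually_notMem_line (F := F) (c := c) (x := x + t₀ • d) (d := e)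
    ⟨s₀, by rwa [← h2]⟩ 0
  have h4 : Tendsto (fun z : ℂ => z / cross d e) (𝓝[≠] 0) (𝓝[≠] 0) := by
    refine tendsto_nhdsWithin_iff.2 ⟨?_, ?_⟩
    · exact (Continuous.tendsto' (by fun_prop) 0 0 (by simp)).mono_left nhdsWithin_le_nhds
    · filter_upwards [self_mem_nhdsWithin] with z hz
      exact div_ne_zero hz he
  filter_upwards [h4.eventually h3] with z hz l hl hlz
  apply hz
  have h5 := cross_smul_eq d e l
  have h6 : l = (cross l e / cross d e) • d + (z / cross d e) • e := by
    rw [← hlz, div_eq_inv_mul, div_eq_inv_mul, mul_smul, mul_smul, ← smul_add, ← h5,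
      smul_smul, inv_mul_cancel₀ he, one_smul]
  have h7 : x + t₀ • d + (z / cross d e) • e =
      x + (t₀ - cross l e / cross d e) • d + l := by
    have h8 : x + (t₀ - cross l e / cross d e) • d + ((cross l e / cross d e) • d +
        (z / cross d e) • e) = x + t₀ • d + (z / cross d e) • e := by
      rw [sub_smul]; abel
    rw [← h8, ← h6]
  rw [h7, add_mem_zeroSet_iff hl]
  exact h _

/-- A line contained in a fiber is spanned by periods: the periods in it form a group of rank at
least `4 - 2`. -/
lemma span_period_eq [DiscreteTopology Λ] [IsZLattice ℝ Λ] (hF : F.Nonconst) (hd : d ≠ 0)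
    (h : ∀ t : ℂ, x + t • d ∈ F.zeroSet c) :
    Submodule.span ℝ ((Λ : Set (ℂ × ℂ)) ∩ ((ℂ ∙ d : Submodule ℂ (ℂ × ℂ)) : Set (ℂ × ℂ))) =
      (ℂ ∙ d : Submodule ℂ (ℂ × ℂ)).restrictScalars ℝ := by
  set L : Submodule ℂ (ℂ × ℂ) := ℂ ∙ d with hL
  let π : Λ →ₗ[ℤ] ℂ := ((crossL d : ℂ × ℂ →ₗ[ℂ] ℂ).restrictScalars ℤ).comp Λ.subtype
  have hπ : ∀ l : Λ, π l = cross d l := fun l => crossL_apply d l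
  have hrange : Module.finrank ℤ (LinearMap.range π) ≤ 2 := by
    have hdisc : DiscreteTopology (LinearMap.range π) := by
      apply discreteTopology_of_isOpen_singleton_zero
      have h1 := eventually_nhdsWithin_iff.1 (eventually_ne_cross_period hF hd h)
      obtain ⟨r, hr, hball⟩ := Metric.eventually_nhds_iff_ball.1 h1
      rw [Metric.isOpen_singleton_iff]
      refine ⟨r, hr, ?_⟩
      rintro ⟨z, l, rfl⟩ hz
      by_contra h0
      refine hball (π l) hz (fun h2 => h0 (Subtype.ext h2)) l l.2 (hπ l).symm
    have hdisc' : DiscreteTopology (Submodule.span ℤ (LinearMap.range π : Set ℂ)) := by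
      rw [Submodule.span_eq]; exact hdisc
    have h2 := Real.finrank_eq_int_finrank_of_discrete hdisc'
    rw [Set.finrank, Set.finrank, Submodule.span_eq] at h2
    rw [← h2, ← Complex.finrank_real_complex]
    exact Submodule.finrank_le _
  have hrank : Module.finrank ℤ Λ = 4 := by
    rw [ZLattice.rank ℝ Λ, Module.finrank_prod, Complex.finrank_real_complex]
  have hadd := (LinearMap.ker π).finrank_quotient_add_finrank
  rw [π.quotKerEquivRange.finrank_eq] at hadd
  set s : Set (ℂ × ℂ) := (Λ : Set (ℂ × ℂ)) ∩ (L : Set (ℂ × ℂ)) with hs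
  let N : Submodule ℤ (ℂ × ℂ) := Λ ⊓ L.restrictScalars ℤ
  have hN : (N : Set (ℂ × ℂ)) = s := rfl
  have hker : Module.finrank ℤ (LinearMap.ker π) = Module.finrank ℤ N := by
    have h1 : (LinearMap.ker π).map Λ.subtype = N := by
      ext y
      constructor
      · rintro ⟨l, hl, rfl⟩
        refine ⟨l.2, ?_⟩
        obtain ⟨t, ht⟩ := exists_eq_smul_of_cross_eq_zero hd ((hπ l).symm.trans hl)
        exact Submodule.mem_span_singleton.2 ⟨t, ht.symm⟩
      · rintro ⟨hy, hyL⟩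
        obtain ⟨t, rfl⟩ := Submodule.mem_span_singleton.1 (show y ∈ L from hyL)
        refine ⟨⟨_, hy⟩, ?_, rfl⟩
        change π _ = 0
        rw [hπ]
        simp [cross]; ring
    rw [← h1]
    exact (Submodule.equivMapOfInjective Λ.subtype Subtype.val_injective _).finrank_eq
  have hNdisc : DiscreteTopology (Submodule.span ℤ s) := by
    rw [← hN, Submodule.span_eq]
    exact DiscreteTopology.of_subset (s := (Λ : Set (ℂ × ℂ))) (by assumption) inf_le_left
  have hfin := Real.finrank_eq_int_finrank_of_discrete hNdisc
  rw [Set.finrank, Set.finrank, ← hN, Submodule.span_eq, hN] at hfin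
  have hLrank : Module.finrank ℝ (L.restrictScalars ℝ) = 2 := by
    have h1 : Module.finrank ℝ L = Module.finrank ℝ ℂ * Module.finrank ℂ L :=
      (Module.finrank_mul_finrank ℝ ℂ L).symm
    rw [Complex.finrank_real_complex, hL, finrank_span_singleton hd] at h1
    exact h1
  refine Submodule.eq_of_le_of_finrank_le (Submodule.span_le.2 fun y hy => hy.2) ?_
  rw [hLrank, hfin]
  omega

lemma isLinearFiber_of_hasLine [DiscreteTopology Λ] [IsZLattice ℝ Λ] (hF : F.Nonconst) (hne : (F.zeroSet c).Nonempty)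
    (h : ∀ q ∈ F.zeroSet c, F.HasLine c q) : F.IsLinearFiber c := by
  have key : ∀ q ∈ F.zeroSet c, ∃ E : Set (Torus Λ),
      IsSubtorus Λ E ∧ E ⊆ F.fiber c ∧ proj Λ q ∈ E := by
    intro q hq
    obtain ⟨d, hd, hline⟩ := h q hq
    have hd0 : d ≠ 0 := by rintro rfl; simp at hd
    refine ⟨_, ⟨ℂ ∙ d, q, finrank_span_singleton hd0, span_period_eq hF hd0 hline, rfl⟩, ?_, ?_⟩
    · rintro _ ⟨v, hv, rfl⟩
      obtain ⟨t, rfl⟩ := Submodule.mem_span_singleton.1 hv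
      exact hline t
    · exact ⟨0, Submodule.zero_mem _, by simp⟩
  refine ⟨{E | IsSubtorus Λ E ∧ E ⊆ F.fiber c}, ?_, fun E hE => hE.1, ?_⟩
  · obtain ⟨q, hq⟩ := hne
    obtain ⟨E, h1, h2, -⟩ := key q hq
    exact ⟨E, h1, h2⟩
  · refine Set.Subset.antisymm ?_ (Set.sUnion_subset fun E hE => hE.2)
    intro t ht
    obtain ⟨q, rfl⟩ := Submodule.Quotient.mk_surjective Λ t
    obtain ⟨E, h1, h2, h3⟩ := key q ht
    exact ⟨E, ⟨h1, h2⟩, h3⟩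

/-- A nonconstant map whose inflection form vanishes has infinitely many linear fibers. -/
lemma infinite_of_infl_eq_zero [DiscreteTopology Λ] [IsZLattice ℝ Λ] (hF : F.Nonconst)
    (hK : ∀ p f g, IsLocalRep F.graph p f g → infl (1, 0) (0, 1) f g p = 0) :
    {c : P1 | F.IsLinearFiber c}.Infinite := by
  intro hfin
  obtain ⟨x, hx⟩ := (hF.dense_compl_support (C := hfin.toFinset)).nonempty
  obtain ⟨f, g, hrep⟩ := F.exists_localRep x
  obtain ⟨c, hc⟩ : ∃ c, x ∈ F.zeroSet c := by
    by_cases h0 : (f x, g x) = (0 : ℂ × ℂ)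
    · have h1 := congrArg Prod.fst h0
      have h2 := congrArg Prod.snd h0
      simp only [Prod.fst_zero, Prod.snd_zero] at h1 h2
      exact ⟨Projectivization.mk ℂ (1, 0) (by simp),
        (mem_zeroSet_mk_iff hrep _).2 (by simp [h1, h2])⟩
    · exact ⟨Projectivization.mk ℂ _ h0, (mem_zeroSet_mk_iff hrep h0).2 (mul_comm _ _)⟩
  have hlin : F.IsLinearFiber c := isLinearFiber_of_hasLine hF ⟨x, hc⟩ fun q hq =>
    hasLine_of_infl_eq_zero hF hK hq
  exact notMem_support_iff.1 hx c (by simpa using hlin) hc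

/-! ### Counting linear fibers -/

lemma nonconst_of_two_linear (h : F.IsLinearFiber c) (h' : F.IsLinearFiber c') (hcc : c ≠ c') :
    F.Nonconst := by
  intro a ha
  wlog hac : a ≠ c' generalizing c c'
  · exact this h' h hcc.symm (by rw [not_not.1 hac]; exact hcc.symm)
  obtain ⟨q, hq⟩ := h'.zeroSet_nonempty
  obtain ⟨l, -, hl, hline⟩ := h'.exists_line hq
  obtain ⟨f, g, hrep⟩ := F.exists_localRep q
  have hlim : Tendsto (fun s : ℂ => q + s • l) (𝓝 0) (𝓝 q) := by simpa using tendsto_line q l 0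
  have h1 := hlim.eventually ((eventually_nhdsWithin_iff.1 hrep.isolated).and hrep.eventually)
  have h2 : ∀ᶠ s in 𝓝[≠] (0 : ℂ), False := by
    filter_upwards [eventually_nhdsWithin_of_eventually_nhds h1, self_mem_nhdsWithin] with s hs hs0
    have h3 := eq_zero_of_member_eq_zero hac ((mem_zeroSet_iff hs.2 a).1 (ha ▸ Set.mem_univ _))
      ((mem_zeroSet_iff hs.2 c').1 (hline s))
    rcases hs.1 (by simpa [hl] using hs0) with h4 | h4
    · exact h4 h3.1
    · exact h4 h3.2
  exact h2.exists.choose_spec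

variable {C : Finset P1} {κ : ℂ}

lemma notMem_support_of_notMem (hrep : IsLocalRep F.graph q f g) (hfg : f q ≠ 0 ∨ g q ≠ 0)
    (hc : c ∉ C) (hq : q ∈ F.zeroSet c) : q ∉ F.support C := by
  rw [notMem_support_iff]
  intro c' hc' hq'
  have := eq_zero_of_member_eq_zero (fun h => hc (by rwa [h])) ((mem_zeroSet_iff hrep c).1 hq)
    ((mem_zeroSet_iff hrep c').1 hq')
  rcases hfg with h | h
  · exact h this.1
  · exact h this.2

/-- If the quotient were zero, the inflection form would vanish and all nonempty fibers would be
linear. -/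
lemma const_ne_zero [DiscreteTopology Λ] [IsZLattice ℝ Λ] (hF : F.Nonconst)
    (hfin : {c : P1 | F.IsLinearFiber c}.Finite)
    (hC : C.card = 6) (hκ : ∀ x, x ∉ F.support C → F.quotFun C x = κ) : κ ≠ 0 := by
  rintro rfl
  refine infinite_of_infl_eq_zero hF (fun p f g hrep => ?_) hfin
  have hbot : (𝓝[(F.support C)ᶜ] p).NeBot :=
    mem_closure_iff_nhdsWithin_neBot.1 (hF.dense_compl_support p)
  have hc := (analyticAt_infl hrep.analytic_left hrep.analytic_right (1, 0) (0, 1)).continuousAt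
  refine tendsto_nhds_unique_of_eventuallyEq (l := 𝓝[(F.support C)ᶜ] p)
    (hc.tendsto.mono_left nhdsWithin_le_nhds) tendsto_const_nhds ?_
  filter_upwards [self_mem_nhdsWithin, eventually_nhdsWithin_of_eventually_nhds hrep.eventually]
    with x hx hrx
  have h1 := hκ x hx
  rw [quotFun_eq hC hrx hx, quot, div_eq_zero_iff] at h1
  refine h1.resolve_right (Finset.prod_ne_zero_iff.2 fun c hc h0 => ?_)
  exact notMem_support_iff.1 hx c hc ((mem_zeroSet_iff hrx c).2 h0)

/-- On a further linear fiber the inflection form vanishes, and the six equations have no zeros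
outside the points of indeterminacy. -/
lemma const_eq_zero_of_linear (hF : F.Nonconst) (hC : C.card = 6)
    (hκ : ∀ x, x ∉ F.support C → F.quotFun C x = κ) (hc : c ∉ C) (hlin : F.IsLinearFiber c) :
    κ = 0 := by
  obtain ⟨q₀, hq₀⟩ := hlin.zeroSet_nonempty
  obtain ⟨l, -, hl, hline⟩ := hlin.exists_line hq₀
  obtain ⟨t, f, g, σ, m, hrep, hfg, -, hm, -, hinfl⟩ :=
    (eventually_isGood_of_line hF hl hline).exists
  have hsupp := notMem_support_of_notMem hrep hfg hc (hline t)
  obtain ⟨M, hM⟩ := hinfl.bound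
  have h0 := hM.self_of_nhds
  rw [sub_self, map_zero, zero_pow (by omega), norm_zero, mul_zero, norm_le_zero_iff] at h0
  rw [← hκ _ hsupp, quotFun_eq hC hrep hsupp, quot, h0, zero_div]

lemma infl_eq_zero_of_sq {h m : ℂ × ℂ → ℂ} {a b : ℂ} (hrep : IsLocalRep F.graph x f g)
    (hab : (a, b) ≠ (0 : ℂ × ℂ)) (hh : AnalyticAt ℂ h x) (hm : AnalyticAt ℂ m x)
    (heq : ∀ᶠ y in 𝓝 x, f y * b - g y * a = h y ^ 2 * m y) (hx : h x = 0) :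
    infl (1, 0) (0, 1) f g x = 0 := by
  have key : ∀ v, wr v f g x = 0 := by
    intro v
    have h1 : dirD v f x * b - dirD v g x * a = 0 := by
      have e1 := dirD_sub (f := fun y => f y * b) (g := fun y => g y * a)
        (hrep.analytic_left.mul analyticAt_const) (hrep.analytic_right.mul analyticAt_const) v
      rw [dirD_mul hrep.analytic_left analyticAt_const,
        dirD_mul hrep.analytic_right analyticAt_const] at e1
      have e2 := (dirD_congr (f := fun y => f y * b - g y * a)
        (g := fun y => h y * (h y * m y))
        (heq.mono fun y hy => by linear_combination hy) v).eq_of_nhds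
      rw [e1, dirD_mul (g := fun y => h y * m y) hh (hh.mul hm), dirD_mul hh hm, hx] at e2
      simpa [dirD] using e2
    have h2 := heq.self_of_nhds
    rw [hx] at h2
    rw [wr]
    by_cases ha : a = 0
    · have hb : b ≠ 0 := fun hb => hab (by rw [ha, hb]; rfl)
      apply mul_left_cancel₀ hb
      linear_combination g x * h1 - dirD v g x * h2
    · apply mul_left_cancel₀ ha
      linear_combination f x * h1 - dirD v f x * h2
  exact infl_eq_zero_of_critical (key _) (key _)

open Asymptotics in
/-- On a multiple component of a fiber the quotient tends to zero. The point used is a zero of the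
repeated factor `h`; there are uncountably many, so the points that are not generic can be
avoided. -/
lemma const_eq_zero_of_not_reduced [DiscreteTopology Λ] (hF : F.Nonconst) (hC : C.card = 6)
    (hCl : ∀ c ∈ C, F.IsLinearFiber c) (hκ : ∀ x, x ∉ F.support C → F.quotFun C x = κ)
    (hc : ¬ F.IsReducedFiber c) : κ = 0 := by
  simp only [IsReducedFiber, not_forall, not_not] at hc
  obtain ⟨p, f, g, hrep, a, b, hab, habc, h, m, hh, hm, heq, hp⟩ := hc
  have hN : {x | IsLocalRep F.graph x f g ∧ AnalyticAt ℂ h x ∧ AnalyticAt ℂ m x ∧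
      (∀ᶠ y in 𝓝 x, f y * b - g y * a = h y ^ 2 * m y) ∧ (x ≠ p → f x ≠ 0 ∨ g x ≠ 0)} ∈ 𝓝 p :=
    hrep.eventually.and (hh.eventually_analyticAt.and (hm.eventually_analyticAt.and
      (heq.eventually_nhds.and (eventually_nhdsWithin_iff.1 hrep.isolated))))
  -- a zero of `h` at which the map is determined and, if `c ∈ C`, the fiber is a multiple line
  obtain ⟨x, ⟨⟨hrx, hhx, hmx, heqx, hfgx⟩, hx0⟩, hxp, hxB⟩ :
      ∃ x, x ∈ {x | x ∈ {x | IsLocalRep F.graph x f g ∧ AnalyticAt ℂ h x ∧ AnalyticAt ℂ m x ∧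
        (∀ᶠ y in 𝓝 x, f y * b - g y * a = h y ^ 2 * m y) ∧ (x ≠ p → f x ≠ 0 ∨ g x ≠ 0)} ∧
        h x = 0} ∧ x ≠ p ∧ (c ∈ C → x ∈ F.zeroSet c → F.IsGood c x) := by
    by_contra! hcon
    refine not_countable_zeros hh hp hN (Set.Countable.mono (s₂ := {p} ∪
      {q | c ∈ C ∧ q ∈ F.zeroSet c ∧ ¬ F.IsGood c q}) ?_ ?_)
    · intro x hx
      by_cases hxp : x = p
      · exact Or.inl hxp
      · exact Or.inr (hcon x hx hxp)
    · refine (Set.countable_singleton p).union ?_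
      by_cases hcC : c ∈ C
      · exact ((hCl c hcC).countable_not_isGood hF).mono fun q hq => hq.2
      · simp [hcC]
  have hfg := hfgx hxp
  have hxc : x ∈ F.zeroSet c := by
    rw [← habc, mem_zeroSet_mk_iff hrx]
    have := heqx.self_of_nhds
    rw [hx0] at this
    linear_combination this
  by_cases hcC : c ∈ C
  swap
  · have hsupp := notMem_support_of_notMem hrx hfg hcC hxc
    rw [← hκ x hsupp, quotFun_eq hC hrx hsupp, quot, infl_eq_zero_of_sq hrx hab hhx hmx heqx hx0,
      zero_div]
  obtain ⟨f₁, g₁, σ, k, hrep₁, hfg₁, hσ0, hk, hσ, hinfl⟩ := hxB hcC hxc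
  have hk2 : 2 ≤ k := by
    by_contra hk1
    obtain rfl : k = 1 := by omega
    obtain ⟨w, hw, -, hf₁, hg₁⟩ := hrx.exists_unit hrep₁ hfg
    obtain ⟨r, hr⟩ : ∃ r : ℂ, r • ((a, b) : ℂ × ℂ) = c.rep := by
      rw [← c.mk_rep] at habc
      exact (Projectivization.mk_eq_mk_iff' ℂ _ _ _ _).1 habc.symm
    have hr1 : r * a = c.rep.1 := by rw [← hr]; rfl
    have hr2 : r * b = c.rep.2 := by rw [← hr]; rfl
    have hhO : h =O[𝓝 x] fun z => ‖z - x‖ := by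
      have := hhx.differentiableAt.isBigO_sub
      simpa [hx0] using this.norm_right
    have hO : member c f₁ g₁ =O[𝓝 x] fun z => ‖z - x‖ ^ 2 := by
      have h1 : (fun z => w z * r * m z) =O[𝓝 x] fun _ => (1 : ℝ) :=
        ((hw.mul analyticAt_const).mul hmx).continuousAt.isBigO_one ℝ
      have h2 := h1.mul (hhO.pow 2)
      refine h2.congr' ?_ (Eventually.of_forall fun z => one_mul _)
      filter_upwards [hf₁, hg₁, heqx] with z h3 h4 h5
      rw [member, h3, h4, ← hr1, ← hr2]
      linear_combination -(w z * r) * h5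
    have h1 : (fun z => σ (z - x)) =O[𝓝 x] fun z => ‖z - x‖ ^ 2 := by
      simpa using hσ.trans hO
    have h2 : HasFDerivAt (fun z => σ (z - x)) (0 : ℂ × ℂ →L[ℂ] ℂ) x :=
      h1.hasFDerivAt one_lt_two
    have h3 : HasFDerivAt (fun z => σ (z - x)) σ x := by
      have := σ.hasFDerivAt.comp x ((hasFDerivAt_id (𝕜 := ℂ) x).sub_const x)
      rwa [ContinuousLinearMap.comp_id] at this
    exact hσ0 (h3.unique h2)
  have hO := exists_isBigO_quotFun hC hcC hxc hrep₁ hfg₁ hk hσ hinfl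
  have hbot : (𝓝[(F.support C)ᶜ] x).NeBot :=
    mem_closure_iff_nhdsWithin_neBot.1 (hF.dense_compl_support x)
  have hlim : Tendsto (fun z => σ (z - x) ^ (2 * k - 2)) (𝓝[(F.support C)ᶜ] x) (𝓝 0) := by
    have : Continuous fun z : ℂ × ℂ => σ (z - x) ^ (2 * k - 2) := by fun_prop
    have := this.tendsto x
    rw [sub_self, map_zero, zero_pow (by omega)] at this
    exact this.mono_left nhdsWithin_le_nhds
  refine tendsto_nhds_unique_of_eventuallyEq (l := 𝓝[(F.support C)ᶜ] x) tendsto_const_nhds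
    (hO.trans_tendsto hlim) ?_
  filter_upwards [self_mem_nhdsWithin] with z hz
  exact (hκ z hz).symm

end MeromorphicMap

end ComplexTorus

theorem theoremT (Λ : Submodule ℤ (ℂ × ℂ)) [DiscreteTopology Λ] [IsZLattice ℝ Λ]
    (F : ComplexTorus.MeromorphicMap Λ)
    (hfin : {c : ComplexTorus.P1 | F.IsLinearFiber c}.Finite) :
    {c : ComplexTorus.P1 | F.IsLinearFiber c}.ncard ≤ 6 ∧
      ({c : ComplexTorus.P1 | F.IsLinearFiber c}.ncard = 6 →
        ∀ c : ComplexTorus.P1, F.IsReducedFiber c) := by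
  open ComplexTorus MeromorphicMap in
  by_cases hlt : {c : P1 | F.IsLinearFiber c}.ncard < 6
  · exact ⟨hlt.le, fun h => absurd h hlt.ne⟩
  rw [Set.ncard_eq_toFinset_card _ hfin] at hlt ⊢
  obtain ⟨C, hsub, hC⟩ := Finset.exists_subset_card_eq (not_lt.1 hlt)
  have hCl : ∀ c ∈ C, F.IsLinearFiber c := fun c hc => by simpa using hsub hc
  have hF : F.Nonconst := by
    obtain ⟨c, hc, c', hc', hcc⟩ := Finset.one_lt_card.1 (by omega : 1 < C.card)
    exact nonconst_of_two_linear (hCl c hc) (hCl c' hc') hcc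
  obtain ⟨κ, hκ⟩ := exists_quotFun_eq_const hF hC hCl
  have hκ0 := const_ne_zero hF hfin hC hκ
  refine ⟨?_, fun _ c => ?_⟩
  · by_contra hgt
    obtain ⟨c, hc, hcC⟩ := Finset.exists_mem_notMem_of_card_lt_card
      (by omega : C.card < hfin.toFinset.card)
    exact hκ0 (const_eq_zero_of_linear hF hC hκ hcC (by simpa using hc))
  · by_contra hc
    exact hκ0 (const_eq_zero_of_not_reduced hF hC hCl hκ hc)
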